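/- Let $a,b>0$ be real with $(a,b)\neq(1,1)$, and consider the planar polynomial system $$\dot x = xy-a(x^3+xy^2),\qquad \dot y = y^2-(by-b+1)(x^2+y^2),$$ for which $s_2=(0,1)$ is a stationary point. 1. If $a<1$, then $s_2$ is a saddle point; its unstable manifold is tangent at $s_2$ to the $x$-direction and its stable manifold is tangent at $s_2$ to the $y$-axis. 2. If $a=1$ and $b>1$, then $s_2$ is an attracting node. If $a=1$ and $b<1$, then $s_2$ is a saddle point; its unstable manifold is tangent at $s_2$ to the $x$-direction and its stable manifold is tangent at $s_2$ to the $y$-axis. 3. If $a>1$, then $s_2$ is an attracting node. Here a stationary point $p$ is a *saddle point* if there are exactly two non-constant trajectories tending to $p$ as $t\to+\infty$ inside some bounded neighbourhood $N$ of $p$ and exactly two tending to $p$ as $t\to-\infty$ inside $N$, all other trajectories starting in $N\setminus\{p\}$ leave $N$ both in forward and in backward time, and no trajectory other than $p$ stays in $N$ for all times. It is an *attracting node* if it is Lyapunov stable and every trajectory starting sufficiently close to $p$, but not at $p$, exists for all $t\ge 0$ and converges to $p$ as $t\to+\infty$ along a well-defined tangent direction, i.e. the unit vectors pointing from $p$ to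 the trajectory converge. The (local) stable, respectively unstable, manifold of $p$ consists of the points whose trajectory stays in a given small neighbourhood of $p$ for all $t\ge0$, respectively all $t\le0$, and converges to $p$ as $t\to+\infty$, respectively $t\to-\infty$; the assertion that it is tangent to a line includes that, for every sufficiently small neighbourhood, it is near $p$ a $C^1$ curve through $p$ with that tangent line. -/

import Mathlib

open Set Filter Topology

/-- The polynomial CDK (Dixon) vector field with parameters `a`, `b`:
`x' = x y - a (x³ + x y²)`, `y' = y² - (b y - b + 1) (x² + y²)`. -/
def cdkField (a b : ℝ) (z : ℝ × ℝ) : ℝ × ℝ :=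
  (z.1 * z.2 - a * (z.1 ^ 3 + z.1 * z.2 ^ 2),
    z.2 ^ 2 - (b * z.2 - b + 1) * (z.1 ^ 2 + z.2 ^ 2))

/-- `γ` solves the autonomous system `z' = F z` on `[0, ∞)`. -/
def IsForwardSolution (F : ℝ × ℝ → ℝ × ℝ) (γ : ℝ → ℝ × ℝ) : Prop :=
  IsIntegralCurveOn γ (fun _ => F) (Ici 0)

/-- `γ` solves the autonomous system `z' = F z` on `(-∞, 0]`. -/
def IsBackwardSolution (F : ℝ × ℝ → ℝ × ℝ) (γ : ℝ → ℝ × ℝ) : Prop :=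
  IsIntegralCurveOn γ (fun _ => F) (Iic 0)

/-- The points whose trajectory stays in `N` for all times `t ≥ 0`. When `N` is bounded, a
trajectory of a locally Lipschitz field that is not of this kind leaves `N` in positive time
(a solution with a finite life time leaves every bounded set). -/
def forwardTrapped (F : ℝ × ℝ → ℝ × ℝ) (N : Set (ℝ × ℝ)) : Set (ℝ × ℝ) :=
  {q | ∃ γ : ℝ → ℝ × ℝ, IsForwardSolution F γ ∧ γ 0 = q ∧ ∀ t, 0 ≤ t → γ t ∈ N}

/-- The points whose trajectory stays in `N` for all times `t ≤ 0`. -/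
def backwardTrapped (F : ℝ × ℝ → ℝ × ℝ) (N : Set (ℝ × ℝ)) : Set (ℝ × ℝ) :=
  {q | ∃ γ : ℝ → ℝ × ℝ, IsBackwardSolution F γ ∧ γ 0 = q ∧ ∀ t, t ≤ 0 → γ t ∈ N}

/-- The local stable manifold of `p` relative to the neighbourhood `N`: the points whose trajectory
stays in `N` for all `t ≥ 0` and converges to `p` as `t → ∞`. -/
def localStableManifold (F : ℝ × ℝ → ℝ × ℝ) (p : ℝ × ℝ) (N : Set (ℝ × ℝ)) : Set (ℝ × ℝ) :=
  {q | ∃ γ : ℝ → ℝ × ℝ, IsForwardSolution F γ ∧ γ 0 = q ∧ (∀ t, 0 ≤ t → γ t ∈ N) ∧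
    Tendsto γ atTop (𝓝 p)}

/-- The local unstable manifold of `p` relative to the neighbourhood `N`: the points whose
trajectory stays in `N` for all `t ≤ 0` and converges to `p` as `t → -∞`. -/
def localUnstableManifold (F : ℝ × ℝ → ℝ × ℝ) (p : ℝ × ℝ) (N : Set (ℝ × ℝ)) : Set (ℝ × ℝ) :=
  {q | ∃ γ : ℝ → ℝ × ℝ, IsBackwardSolution F γ ∧ γ 0 = q ∧ (∀ t, t ≤ 0 → γ t ∈ N) ∧
    Tendsto γ atBot (𝓝 p)}

/-- Saddle point of a planar (locally Lipschitz) system: two distinct trajectories tend to `p` as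
`t → ∞`, two distinct trajectories tend to `p` as `t → -∞`, and there is a bounded neighbourhood
`N` of `p` such that every other trajectory starting in `N \ {p}` leaves `N` both in forward and
in backward time, and no trajectory other than `p` stays in `N` for all times. -/
structure IsSaddlePoint (F : ℝ × ℝ → ℝ × ℝ) (p : ℝ × ℝ) : Prop where
  stationary : F p = 0
  separatrices : ∃ N ∈ 𝓝 p, Bornology.IsBounded N ∧
    (∃ γ₁ γ₂ : ℝ → ℝ × ℝ,
      IsForwardSolution F γ₁ ∧ IsForwardSolution F γ₂ ∧
      Tendsto γ₁ atTop (𝓝 p) ∧ Tendsto γ₂ atTop (𝓝 p) ∧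
      γ₁ 0 ≠ p ∧ γ₂ 0 ≠ p ∧
      Disjoint (γ₁ '' Ici 0) (γ₂ '' Ici 0) ∧
      forwardTrapped F N ⊆ {p} ∪ γ₁ '' Ici 0 ∪ γ₂ '' Ici 0) ∧
    (∃ γ₃ γ₄ : ℝ → ℝ × ℝ,
      IsBackwardSolution F γ₃ ∧ IsBackwardSolution F γ₄ ∧
      Tendsto γ₃ atBot (𝓝 p) ∧ Tendsto γ₄ atBot (𝓝 p) ∧
      γ₃ 0 ≠ p ∧ γ₄ 0 ≠ p ∧
      Disjoint (γ₃ '' Iic 0) (γ₄ '' Iic 0) ∧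
      backwardTrapped F N ⊆ {p} ∪ γ₃ '' Iic 0 ∪ γ₄ '' Iic 0) ∧
    forwardTrapped F N ∩ backwardTrapped F N = {p}

/-- Attracting node of a planar system: a stationary point `p` that is Lyapunov stable and such
that every trajectory starting close to `p` (and different from `p`) exists for all positive times
and converges to `p` along a well-defined tangent direction. The limit of the unit vectors
pointing from `p` to `γ t` exists for one norm of the plane if and only if it exists for every
other norm. -/
structure IsAttractingNode (F : ℝ × ℝ → ℝ × ℝ) (p : ℝ × ℝ) : Prop where
  stationary : F p = 0
  stable : ∀ N ∈ 𝓝 p, ∃ M ∈ 𝓝 p, ∀ γ : ℝ → ℝ × ℝ,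
    IsForwardSolution F γ → γ 0 ∈ M → ∀ t, 0 ≤ t → γ t ∈ N
  attracting : ∃ M ∈ 𝓝 p,
    (∀ q ∈ M, ∃ γ : ℝ → ℝ × ℝ, IsForwardSolution F γ ∧ γ 0 = q) ∧
    ∀ γ : ℝ → ℝ × ℝ, IsForwardSolution F γ → γ 0 ∈ M → γ 0 ≠ p →
      Tendsto γ atTop (𝓝 p) ∧
      ∃ d : ℝ × ℝ, Tendsto (fun t => ‖γ t - p‖⁻¹ • (γ t - p)) atTop (𝓝 d)

/-- Near `p`, the set `S` is a one-dimensional `C¹` submanifold of the plane that passes through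
`p` and whose tangent line at `p` is spanned by `v`: it is the graph of a `C¹` function `h` with
`h 0 = 0`, `h' 0 = 0` over the line `p + ℝ v`, with values in the orthogonal direction. -/
def IsC1CurveTangentTo (S : Set (ℝ × ℝ)) (p v : ℝ × ℝ) : Prop :=
  v ≠ 0 ∧ ∃ V ∈ 𝓝 p, ∃ ε : ℝ, 0 < ε ∧ ∃ h : ℝ → ℝ,
    ContDiffOn ℝ 1 h (Ioo (-ε) ε) ∧ h 0 = 0 ∧ deriv h 0 = 0 ∧
    S ∩ V = (fun s : ℝ => p + s • v + h s • ((-v.2, v.1) : ℝ × ℝ)) '' Ioo (-ε) ε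

/-- The stable manifold of `p` is a `C¹` curve with tangent direction `v` at `p`
(for the local stable manifolds relative to all sufficiently small neighbourhoods). -/
def StableManifoldTangentTo (F : ℝ × ℝ → ℝ × ℝ) (p v : ℝ × ℝ) : Prop :=
  ∃ U ∈ 𝓝 p, ∀ N ∈ 𝓝 p, N ⊆ U → IsC1CurveTangentTo (localStableManifold F p N) p v

/-- The unstable manifold of `p` is a `C¹` curve with tangent direction `v` at `p`
(for the local unstable manifolds relative to all sufficiently small neighbourhoods). -/
def UnstableManifoldTangentTo (F : ℝ × ℝ → ℝ × ℝ) (p v : ℝ × ℝ) : Prop :=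
  ∃ U ∈ 𝓝 p, ∀ N ∈ 𝓝 p, N ⊆ U → IsC1CurveTangentTo (localUnstableManifold F p N) p v

/-! With `y = 1 + w` and `u = x ^ 2` the system reads `x' = x * g(u, w)`, `w' = G(u, w)`, where `g`
is `radialRate` and `G` is `heightRate`. To first order at the stationary point, `x' = (1 - a) x`
and `w' = -b w`. For `a = 1` the centre manifold is `w ≈ -x ^ 2 / b`, and on it `x' ≈ (1 / b - 1) x
^ 3`, so `b` decides. The hyperbolic and the degenerate case are treated together throughout.

Saddle. The `y`-axis is invariant and is the stable curve. A trajectory off the axis cannot stay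
nearby, because `x ^ 2 * exp (-2 B w)` with `B = (2 a - 1) / b` grows exponentially along it
(`fst_eq_zero_of_forwardTrapped`). The unstable curve is sought as `w = H u`, which solves `H' = G /
(2 u g)`, singular at `u = 0`. The right-hand side decreases in `w` and points into the funnel `|w +
c u| ≤ K u ^ 2`, so solutions started ever closer to `u = 0` converge to a solution
(`exists_solution_in_funnel`, `exists_graph_over_sq`). The bound `|G| ≤ C u g` makes `x ↦ H (x ^ 2)`
a `C¹` function. The distance `w - h x` to the graph grows exponentially in backward time, so only
points of the graph are trapped (`exists_isStableCurve_graph`). Time reversal turns unstable objects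
into stable ones.

Node. The squared distance `V` to the stationary point satisfies `V' ≤ -2 κ V ^ 2` nearby
(`exists_lyapunov`), which gives stability, global existence and convergence. For a limiting
direction with `x > 0`, each slope `k ≠ 0` admits a curve `w = k x - A x ^ 2` that the flow crosses
in one direction only (`exists_transversal`). Hence `w / x` cannot oscillate across `k` and
converges in the extended reals. -/

/-! ### Ordinary differential equations on a half-line -/

/-- A bounded globally Lipschitz vector field has an integral curve through every point that is
defined for all times. -/
theorem exists_isIntegralCurve_of_lipschitz {E : Type*} [NormedAddCommGroup E] [NormedSpace ℝ E]
    [CompleteSpace E] {v : E → E} {K : NNReal} (hv : LipschitzWith K v) {L : ℝ}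
    (hL : ∀ z, ‖v z‖ ≤ L) (q : E) : ∃ γ : ℝ → E, γ 0 = q ∧ ∀ t, HasDerivAt γ (v (γ t)) t := by
  have hL0 : 0 ≤ L := (norm_nonneg _).trans (hL q)
  have key : ∀ n : ℕ, ∃ γ : ℝ → E, γ 0 = q ∧
      ∀ t ∈ Ioo (-(n + 1 : ℝ)) (n + 1), HasDerivAt γ (v (γ t)) t := by
    intro n
    have h0 : (0 : ℝ) ∈ Icc (-(n + 1 : ℝ)) (n + 1) := by
      constructor <;> [linarith [n.cast_nonneg (α := ℝ)]; positivity]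
    have hP : IsPicardLindelof (fun _ : ℝ => v) (⟨0, h0⟩ : Icc (-(n + 1 : ℝ)) (n + 1)) q
        (L.toNNReal * (n + 1)) 0 L.toNNReal K := by
      refine ⟨fun t _ => hv.lipschitzOnWith, fun x _ => continuousOn_const, fun t _ x _ => ?_, ?_⟩
      · rw [Real.coe_toNNReal _ hL0]; exact hL x
      · simp
    obtain ⟨γ, h1, h2⟩ := hP.exists_eq_forall_mem_Icc_hasDerivWithinAt₀
    exact ⟨γ, h1, fun t ht => (h2 t (Ioo_subset_Icc_self ht)).hasDerivAt (Icc_mem_nhds ht.1 ht.2)⟩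
  choose γ hγ0 hγ using key
  have agree : ∀ m n : ℕ, m ≤ n → EqOn (γ m) (γ n) (Ioo (-(m + 1 : ℝ)) (m + 1)) := by
    intro m n hmn
    have hmn' : (m : ℝ) ≤ n := by exact_mod_cast hmn
    refine ODE_solution_unique_of_mem_Ioo (v := fun _ => v) (s := fun _ => univ) (K := K) (t₀ := 0)
      (fun t _ => hv.lipschitzOnWith) ⟨by linarith [m.cast_nonneg (α := ℝ)], by positivity⟩
      (fun t ht => ⟨hγ m t ht, mem_univ _⟩)
      (fun t ht => ⟨hγ n t ⟨by linarith [ht.1], by linarith [ht.2]⟩, mem_univ _⟩) ?_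
    rw [hγ0, hγ0]
  -- Solution number `n` lives on `(-(n + 1), n + 1)`, so `n = ⌊|t|⌋₊` is always admissible at time
  -- `t`.
  refine ⟨fun t => γ ⌊|t|⌋₊ t, by simp [hγ0], fun t => ?_⟩
  -- The next index represents the glued curve on a whole neighbourhood of `t`, across the jumps of
  -- the floor.
  set n := ⌊|t|⌋₊ + 1 with hn
  have ht : |t| < n := by rw [hn]; push_cast; exact Nat.lt_floor_add_one _
  have heq : ∀ s : ℝ, |s| < n → γ ⌊|s|⌋₊ s = γ n s := by
    intro s hs
    refine agree _ _ ?_ (abs_lt.1 (Nat.lt_floor_add_one |s|))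
    exact Nat.floor_le_of_le hs.le
  have hev : (fun s => γ ⌊|s|⌋₊ s) =ᶠ[𝓝 t] γ n := by
    filter_upwards [(continuous_abs.tendsto t).eventually (gt_mem_nhds ht)] with s hs
    exact heq s hs
  have := hγ n t (abs_lt.1 (ht.trans (lt_add_one _)))
  simp only
  rw [heq t ht]
  exact this.congr_of_eventuallyEq hev

/-- A vector field that is Lipschitz and bounded on the image of a nonexpansive map can be solved
globally after composition with this map. -/
theorem exists_isIntegralCurve_comp {E : Type*} [NormedAddCommGroup E] [NormedSpace ℝ E]
    [CompleteSpace E] {v : E → E} {S : Set E} (hS : IsCompact S) {K : NNReal}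
    (hv : LipschitzOnWith K v S) {ρ : E → E} (hρ : LipschitzWith 1 ρ) (hmap : ∀ z, ρ z ∈ S)
    (q : E) : ∃ γ : ℝ → E, γ 0 = q ∧ ∀ t, HasDerivAt γ (v (ρ (γ t))) t := by
  obtain ⟨L, hL⟩ := hS.exists_bound_of_continuousOn hv.continuousOn
  have : LipschitzWith (K * 1) (v ∘ ρ) := by
    rw [← lipschitzOnWith_univ]
    exact hv.comp hρ.lipschitzOnWith (fun z _ => hmap z)
  exact exists_isIntegralCurve_of_lipschitz this (fun z => hL _ (hmap z)) q

/-! ### Scalar differential equations and inequalities on `[0, ∞)` -/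

section HalfLine

variable {y y' : ℝ → ℝ}

theorem continuousOn_Ici_of_hasDerivWithinAt
    (hy : ∀ t, 0 ≤ t → HasDerivWithinAt y (y' t) (Ici 0) t) : ContinuousOn y (Ici 0) :=
  fun t ht => (hy t ht).continuousWithinAt

theorem antitoneOn_Ici_of_hasDerivWithinAt
    (hy : ∀ t, 0 ≤ t → HasDerivWithinAt y (y' t) (Ici 0) t) (h : ∀ t, 0 ≤ t → y' t ≤ 0) :
    AntitoneOn y (Ici 0) :=
  antitoneOn_of_hasDerivWithinAt_nonpos (convex_Ici 0) (continuousOn_Ici_of_hasDerivWithinAt hy)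
    (fun t ht => (hy t (interior_subset ht)).mono interior_subset)
    (fun t ht => h t (interior_subset ht))

/-- A nonnegative function that decreases at a definite rate wherever it is not small tends
to zero. -/
theorem tendsto_zero_of_deriv_le (hy : ∀ t, 0 ≤ t → HasDerivWithinAt y (y' t) (Ici 0) t)
    (hpos : ∀ t, 0 ≤ t → 0 ≤ y t) (hneg : ∀ t, 0 ≤ t → y' t ≤ 0)
    (hrate : ∀ η > 0, ∃ m > 0, ∀ t, 0 ≤ t → η ≤ y t → y' t ≤ -m) :
    Tendsto y atTop (𝓝 0) := by
  have hanti := antitoneOn_Ici_of_hasDerivWithinAt hy hneg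
  rw [Metric.tendsto_atTop]
  intro η hη
  obtain ⟨m, hm, hrate⟩ := hrate η hη
  have : ∃ T, 0 ≤ T ∧ y T < η := by
    by_contra! hcon
    have h2 : AntitoneOn (fun t => y t + m * t) (Ici 0) := by
      refine antitoneOn_Ici_of_hasDerivWithinAt (y' := fun t => y' t + m) (fun t ht => ?_)
        (fun t ht => by linarith [hrate t ht (hcon t ht)])
      simpa using (hy t ht).fun_add ((hasDerivWithinAt_id t _).const_mul m)
    have hT : 0 ≤ (y 0 + 1) / m := div_nonneg (by linarith [hpos 0 le_rfl]) hm.le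
    have h3 := h2 (mem_Ici.2 le_rfl) (mem_Ici.2 hT) hT
    simp only [mul_div_cancel₀ _ hm.ne', mul_zero] at h3
    linarith [hpos _ hT]
  obtain ⟨T, hT, hyT⟩ := this
  refine ⟨T, fun t ht => ?_⟩
  rw [Real.dist_0_eq_abs, abs_of_nonneg (hpos t (hT.trans ht))]
  exact (hanti hT (mem_Ici.2 (hT.trans ht)) ht).trans_lt hyT

/-- A bounded function that grows at least exponentially starts at a nonpositive value. -/
theorem nonpos_of_growth (hy : ∀ t, 0 ≤ t → HasDerivWithinAt y (y' t) (Ici 0) t) {κ B : ℝ}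
    (hκ : 0 < κ) (hgrow : ∀ t, 0 ≤ t → κ * y t ≤ y' t) (hB : ∀ t, 0 ≤ t → y t ≤ B) :
    y 0 ≤ 0 := by
  -- `y t * exp (-κ t)` is nondecreasing, yet bounded above by `B * exp (-κ t)`, which tends to `0`.
  have h1 : AntitoneOn (fun t => -(y t * Real.exp (-κ * t))) (Ici 0) := by
    refine antitoneOn_Ici_of_hasDerivWithinAt
      (y' := fun t => -(y' t * Real.exp (-κ * t) + y t * (Real.exp (-κ * t) * (-κ))))
      (fun t ht => ?_) (fun t ht => ?_)
    · have h2 : HasDerivWithinAt (fun t => Real.exp (-κ * t)) (Real.exp (-κ * t) * (-κ))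
          (Ici 0) t := by
        simpa using (((hasDerivAt_id t).const_mul (-κ)).exp).hasDerivWithinAt
      exact ((hy t ht).mul h2).neg
    · have := mul_nonneg (sub_nonneg.2 (hgrow t ht)) (Real.exp_pos (-κ * t)).le
      linarith
  have h2 : Tendsto (fun t => B * Real.exp (-κ * t)) atTop (𝓝 (B * 0)) := by
    refine Tendsto.const_mul _ (Real.tendsto_exp_atBot.comp ?_)
    exact tendsto_id.const_mul_atTop_of_neg (by linarith)
  rw [mul_zero] at h2
  refine ge_of_tendsto h2 ?_
  filter_upwards [eventually_ge_atTop 0] with t ht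
  have h3 := h1 (mem_Ici.2 le_rfl) (mem_Ici.2 ht) ht
  simp only [mul_zero, Real.exp_zero, mul_one] at h3
  have h4 := mul_le_mul_of_nonneg_right (hB t ht) (Real.exp_pos (-κ * t)).le
  linarith

/-- A function whose derivative is eventually positive at each of its zeros eventually has
constant sign. -/
theorem eventually_nonneg_or_nonpos (hy : ∀ t, 0 ≤ t → HasDerivWithinAt y (y' t) (Ici 0) t)
    (hcross : ∀ᶠ t in atTop, y t = 0 → 0 < y' t) :
    (∀ᶠ t in atTop, 0 ≤ y t) ∨ ∀ᶠ t in atTop, y t ≤ 0 := by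
  by_cases h : ∀ᶠ t in atTop, y t ≤ 0
  · exact Or.inr h
  left
  obtain ⟨T, hT⟩ := eventually_atTop.1 (hcross.and (eventually_ge_atTop 0))
  obtain ⟨t₀, ht₀, hy₀⟩ : ∃ t₀ ≥ T, 0 < y t₀ := by
    by_contra! hcon
    exact h (eventually_atTop.2 ⟨T, hcon⟩)
  refine eventually_atTop.2 ⟨t₀, fun t ht => ?_⟩
  have hsub : Icc t₀ t ⊆ Ici 0 := fun s hs => (hT s (ht₀.trans hs.1)).2
  have := image_le_of_deriv_right_lt_deriv_boundary (f := fun t => -y t) (f' := fun t => -y' t)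
    (B := fun _ => 0) (B' := fun _ => 0) (a := t₀) (b := t)
    ((continuousOn_Ici_of_hasDerivWithinAt hy).neg.mono hsub)
    (fun s hs => ((hy s (hsub ⟨hs.1, hs.2.le⟩)).mono (Ici_subset_Ici.2
      (hsub ⟨hs.1, hs.2.le⟩))).neg) (by simpa using hy₀.le) (fun s => hasDerivAt_const s 0)
    (fun s hs h0 => by
      have := (hT s (ht₀.trans hs.1)).1 (by linarith)
      linarith) (right_mem_Icc.2 ht)
  linarith

/-- A function whose derivative is negative on the level `ρ` stays below this level. -/
theorem le_of_deriv_neg_of_eq (hy : ∀ t, 0 ≤ t → HasDerivWithinAt y (y' t) (Ici 0) t) {ρ : ℝ}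
    (h0 : y 0 ≤ ρ) (h : ∀ t, 0 ≤ t → y t = ρ → y' t < 0) (t : ℝ) (ht : 0 ≤ t) : y t ≤ ρ :=
  image_le_of_deriv_right_lt_deriv_boundary (f' := y') (B := fun _ => ρ) (B' := fun _ => 0)
    (a := 0) (b := t) ((continuousOn_Ici_of_hasDerivWithinAt hy).mono Icc_subset_Ici_self)
    (fun s hs => (hy s hs.1).mono (Ici_subset_Ici.2 hs.1)) h0 (fun s => hasDerivAt_const s ρ)
    (fun s hs => h s hs.1) (right_mem_Icc.2 ht)

/-- Solutions of a scalar homogeneous linear equation are multiples of an exponential. -/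
theorem exists_eq_mul_exp {q : ℝ → ℝ} (hq : ContinuousOn q (Ici 0))
    (hy : ∀ t, 0 ≤ t → HasDerivWithinAt y (y t * q t) (Ici 0) t) :
    ∃ I : ℝ → ℝ, ∀ t, 0 ≤ t → y t = y 0 * Real.exp (I t) := by
  -- Freezing `q` at its value in `0` for negative times gives a continuous function on the line,
  -- whose primitive is differentiable everywhere.
  have hc : Continuous fun t => q (max 0 t) :=
    hq.comp_continuous (by fun_prop) (fun t => le_max_left 0 t)
  set I : ℝ → ℝ := fun t => ∫ s in (0 : ℝ)..t, q (max 0 s)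
  have hI : ∀ t, HasDerivAt I (q (max 0 t)) t := fun t =>
    intervalIntegral.integral_hasDerivAt_right (hc.intervalIntegrable _ _)
      hc.stronglyMeasurable.stronglyMeasurableAtFilter hc.continuousAt
  have hder : ∀ t, 0 ≤ t → HasDerivWithinAt (fun t => y t * Real.exp (-I t)) 0 (Ici 0) t := by
    intro t ht
    have h1 := (hy t ht).mul ((hI t).neg.exp.hasDerivWithinAt (s := Ici 0))
    rw [max_eq_right ht] at h1
    exact h1.congr_deriv (by ring)
  refine ⟨I, fun t ht => ?_⟩
  have h2 := constant_of_has_deriv_right_zero (a := 0) (b := t)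
    ((continuousOn_Ici_of_hasDerivWithinAt (y' := fun _ => 0) hder).mono Icc_subset_Ici_self)
    (fun s hs => (hder s hs.1).mono (Ici_subset_Ici.2 hs.1)) t (right_mem_Icc.2 ht)
  simp only [I, intervalIntegral.integral_same, neg_zero, Real.exp_zero, mul_one] at h2
  rw [← h2, mul_assoc, ← Real.exp_add]
  simp [I]

end HalfLine

/-- The flow of a scalar vector field that vanishes at `0` and is negative on `(0, δ]`: the
solution through `δ` decreases to `0` and sweeps out `(0, δ]`. -/
theorem exists_scalar_solution {X : ℝ → ℝ} {δ : ℝ} (hδ : 0 < δ) {K : NNReal}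
    (hX : LipschitzOnWith K X (Icc 0 δ)) (h0 : X 0 = 0) (hneg : ∀ s ∈ Ioc 0 δ, X s < 0) :
    ∃ y : ℝ → ℝ, y 0 = δ ∧ (∀ t, 0 ≤ t → HasDerivWithinAt y (X (y t)) (Ici 0) t) ∧
      Tendsto y atTop (𝓝 0) ∧ y '' Ici 0 = Ioc 0 δ := by
  -- Clipping to `[0, δ]` makes the field bounded and globally Lipschitz. The solution never leaves
  -- `[0, δ]` in positive time, so the clipping is inactive.
  set ρ : ℝ → ℝ := fun s => max 0 (min δ s)
  have hρ : LipschitzWith 1 ρ := (LipschitzWith.id.const_min δ).const_max 0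
  have hρmem : ∀ s, ρ s ∈ Icc 0 δ := fun s =>
    ⟨le_max_left _ _, max_le hδ.le (min_le_left _ _)⟩
  have hρid : ∀ s ∈ Icc 0 δ, ρ s = s := fun s hs => by simp [ρ, hs.1, hs.2]
  obtain ⟨y, hy0, hy⟩ := exists_isIntegralCurve_comp isCompact_Icc hX hρ hρmem δ
  have hcont : Continuous y := continuous_iff_continuousAt.2 fun t => (hy t).continuousAt
  have hXle : ∀ s ∈ Icc 0 δ, X s ≤ 0 := by
    intro s hs
    rcases hs.1.eq_or_lt with h | h
    · rw [← h, h0]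
    · exact (hneg s ⟨h, hs.2⟩).le
  have hy' : ∀ t, 0 ≤ t → HasDerivWithinAt y (X (ρ (y t))) (Ici 0) t := fun t _ =>
    (hy t).hasDerivWithinAt
  have hanti := antitoneOn_Ici_of_hasDerivWithinAt hy' (fun t _ => hXle _ (hρmem _))
  have hle : ∀ t, 0 ≤ t → y t ≤ δ := fun t ht =>
    hy0 ▸ hanti (mem_Ici.2 le_rfl) (mem_Ici.2 ht) ht
  -- By uniqueness, a solution that reaches `0` would be the constant solution `0`.
  have hne : ∀ t, y t ≠ 0 := by
    intro t ht
    have hlip : LipschitzWith (K * 1) (X ∘ ρ) := by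
      rw [← lipschitzOnWith_univ]
      exact hX.comp hρ.lipschitzOnWith (fun z _ => hρmem z)
    have := ODE_solution_unique_univ (v := fun _ => X ∘ ρ) (s := fun _ => univ) (f := y)
      (g := fun _ => 0) (t₀ := t) (fun _ => hlip.lipschitzOnWith)
      (fun t => ⟨hy t, mem_univ _⟩)
      (fun t => ⟨by
        simpa [hρid 0 ⟨le_rfl, hδ.le⟩, h0] using hasDerivAt_const t (0 : ℝ), mem_univ _⟩) ht
    rw [this] at hy0
    exact hδ.ne hy0
  have hpos : ∀ t, 0 ≤ t → 0 < y t := by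
    intro t ht
    by_contra! hcon
    obtain ⟨s, -, hs⟩ := intermediate_value_Icc' ht hcont.continuousOn
      (show (0 : ℝ) ∈ Icc (y t) (y 0) from ⟨hcon, hy0 ▸ hδ.le⟩)
    exact hne s hs
  have hmem : ∀ t, 0 ≤ t → y t ∈ Icc 0 δ := fun t ht => ⟨(hpos t ht).le, hle t ht⟩
  have hsol : ∀ t, 0 ≤ t → HasDerivWithinAt y (X (y t)) (Ici 0) t := by
    intro t ht
    have := hy' t ht
    rwa [hρid _ (hmem t ht)] at this
  have hlim : Tendsto y atTop (𝓝 0) := by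
    refine tendsto_zero_of_deriv_le hsol (fun t ht => (hpos t ht).le)
      (fun t ht => hXle _ (hmem t ht)) (fun η hη => ?_)
    by_cases hηδ : η ≤ δ
    · obtain ⟨s, hs, hmax⟩ := isCompact_Icc.exists_isMaxOn (nonempty_Icc.2 hηδ)
        (hX.continuousOn.mono (Icc_subset_Icc_left hη.le))
      refine ⟨-X s, by linarith [hneg s ⟨hη.trans_le hs.1, hs.2⟩], fun t ht hηt => ?_⟩
      rw [neg_neg]
      exact hmax ⟨hηt, hle t ht⟩
    · exact ⟨1, one_pos, fun t ht h => absurd (h.trans (hle t ht)) hηδ⟩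
  refine ⟨y, hy0, hsol, hlim, Subset.antisymm ?_ ?_⟩
  · rintro _ ⟨t, ht, rfl⟩
    exact ⟨hpos t ht, hle t ht⟩
  · intro s hs
    obtain ⟨T, hT⟩ := eventually_atTop.1
      ((hlim.eventually (gt_mem_nhds hs.1)).and (eventually_ge_atTop 0))
    obtain ⟨t, ht, hts⟩ := intermediate_value_Icc' (hT T le_rfl).2 hcont.continuousOn
      (show s ∈ Icc (y T) (y 0) from ⟨(hT T le_rfl).1.le, hy0.symm ▸ hs.2⟩)
    exact ⟨t, ht.1, hts⟩

/-! ### Solutions in a funnel -/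

/-- A scalar equation `w' = f u w` whose right-hand side points into the funnel `φ ≤ w ≤ ψ` on
`[r, ε]` has a solution that starts on the upper boundary and stays in the funnel. -/
theorem exists_solution_in_funnel_Icc {f : ℝ → ℝ → ℝ} {φ ψ φ' ψ' : ℝ → ℝ} {r ε : ℝ} (hr : r ≤ ε)
    (hφ : ∀ u ∈ Icc r ε, HasDerivAt φ (φ' u) u) (hψ : ∀ u ∈ Icc r ε, HasDerivAt ψ (ψ' u) u)
    (hle : ∀ u ∈ Icc r ε, φ u ≤ ψ u)
    (hf : ContinuousOn (fun p : ℝ × ℝ => f p.1 p.2)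
      {p | p.1 ∈ Icc r ε ∧ p.2 ∈ Icc (φ p.1) (ψ p.1)})
    {K : NNReal} (hlip : ∀ u ∈ Icc r ε, LipschitzOnWith K (f u) (Icc (φ u) (ψ u)))
    (hanti : ∀ u ∈ Icc r ε, AntitoneOn (f u) (Icc (φ u) (ψ u)))
    (hlow : ∀ u ∈ Icc r ε, φ' u < f u (φ u)) (hup : ∀ u ∈ Icc r ε, f u (ψ u) < ψ' u) :
    ∃ w : ℝ → ℝ, ∀ u ∈ Icc r ε, w u ∈ Icc (φ u) (ψ u) ∧
      HasDerivWithinAt w (f u (w u)) (Icc r ε) u := by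
  have hφc : ContinuousOn φ (Icc r ε) := fun u hu => (hφ u hu).continuousAt.continuousWithinAt
  have hψc : ContinuousOn ψ (Icc r ε) := fun u hu => (hψ u hu).continuousAt.continuousWithinAt
  -- Clipping to the funnel makes the equation globally solvable. Monotonicity in `w` bounds the
  -- clipped right-hand side by its values on the two boundary curves, and the inward conditions
  -- keep the solution inside, where the clipping has no effect.
  set c : ℝ → ℝ → ℝ := fun u w => max (φ u) (min (ψ u) w) with hc
  have hcmem : ∀ u ∈ Icc r ε, ∀ w, c u w ∈ Icc (φ u) (ψ u) := fun u hu w =>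
    ⟨le_max_left _ _, max_le (hle u hu) (min_le_left _ _)⟩
  have hcid : ∀ u, ∀ w ∈ Icc (φ u) (ψ u), c u w = w := fun u w hw => by simp [hc, hw.1, hw.2]
  have hclip : ∀ u, LipschitzWith 1 (c u) := fun u =>
    (LipschitzWith.id.const_min (ψ u)).const_max (φ u)
  have hft : ∀ w, ContinuousOn (fun u => f u (c u w)) (Icc r ε) := fun w =>
    hf.comp (f := fun u => (u, c u w))
      (continuousOn_id.prodMk (hφc.sup (hψc.inf continuousOn_const)))
      (fun u hu => ⟨hu, hcmem u hu w⟩)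
  have hfφ : ContinuousOn (fun u => f u (φ u)) (Icc r ε) :=
    hf.comp (f := fun u => (u, φ u)) (continuousOn_id.prodMk hφc)
      (fun u hu => ⟨hu, left_mem_Icc.2 (hle u hu)⟩)
  have hfψ : ContinuousOn (fun u => f u (ψ u)) (Icc r ε) :=
    hf.comp (f := fun u => (u, ψ u)) (continuousOn_id.prodMk hψc)
      (fun u hu => ⟨hu, right_mem_Icc.2 (hle u hu)⟩)
  obtain ⟨L₁, hL₁⟩ := isCompact_Icc.exists_bound_of_continuousOn hfφ
  obtain ⟨L₂, hL₂⟩ := isCompact_Icc.exists_bound_of_continuousOn hfψ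
  have hrmem : r ∈ Icc r ε := left_mem_Icc.2 hr
  have hL0 : 0 ≤ max L₁ L₂ := ((norm_nonneg _).trans (hL₁ r hrmem)).trans (le_max_left _ _)
  have hP : IsPicardLindelof (fun u w => f u (c u w)) (⟨r, hrmem⟩ : Icc r ε) (ψ r)
      ((max L₁ L₂).toNNReal * (ε - r).toNNReal) 0 (max L₁ L₂).toNNReal (K * 1) := by
    refine ⟨fun u hu => ?_, fun w _ => hft w, fun u hu w _ => ?_, ?_⟩
    · exact ((hlip u hu).comp (hclip u).lipschitzOnWith (fun w _ => hcmem u hu w)).mono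
        (subset_univ _)
    · rw [Real.coe_toNNReal _ hL0, Real.norm_eq_abs, abs_le]
      have h1 := hanti u hu (left_mem_Icc.2 (hle u hu)) (hcmem u hu w) (hcmem u hu w).1
      have h2 := hanti u hu (hcmem u hu w) (right_mem_Icc.2 (hle u hu)) (hcmem u hu w).2
      have h3 := (abs_le.1 (hL₁ u hu)).2
      have h4 := (abs_le.1 (hL₂ u hu)).1
      have h5 := le_max_left L₁ L₂
      have h6 := le_max_right L₁ L₂
      constructor <;> linarith
    · simp [hr]
  obtain ⟨w, hw0, hw⟩ := hP.exists_eq_forall_mem_Icc_hasDerivWithinAt₀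
  simp only at hw0 hw
  have hwc : ContinuousOn w (Icc r ε) := fun u hu => (hw u hu).continuousWithinAt
  have hright : ∀ u ∈ Ico r ε, HasDerivWithinAt w (f u (c u (w u))) (Ici u) u := fun u hu =>
    (hw u (Ico_subset_Icc_self hu)).mono_of_mem_nhdsWithin
      (mem_of_superset (Icc_mem_nhdsGE hu.2) (Icc_subset_Icc_left hu.1))
  have hupper : ∀ u ∈ Icc r ε, w u ≤ ψ u :=
    image_le_of_deriv_right_lt_deriv_boundary' hwc hright hw0.le hψc
      (fun u hu => (hψ u (Ico_subset_Icc_self hu)).hasDerivWithinAt) (fun u hu h => by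
        rw [h, hcid u _ (right_mem_Icc.2 (hle u (Ico_subset_Icc_self hu)))]
        exact hup u (Ico_subset_Icc_self hu))
  have hlower : ∀ u ∈ Icc r ε, φ u ≤ w u :=
    image_le_of_deriv_right_lt_deriv_boundary' hφc
      (fun u hu => (hφ u (Ico_subset_Icc_self hu)).hasDerivWithinAt)
      (hw0 ▸ hle r hrmem) hwc hright (fun u hu h => by
        rw [← h, hcid u _ (left_mem_Icc.2 (hle u (Ico_subset_Icc_self hu)))]
        exact hlow u (Ico_subset_Icc_self hu))
  refine ⟨w, fun u hu => ⟨⟨hlower u hu, hupper u hu⟩, ?_⟩⟩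
  have := hw u hu
  rwa [hcid u _ ⟨hlower u hu, hupper u hu⟩] at this

/-- A scalar equation `w' = f u w` on `(0, ε]`, possibly singular at `u = 0`, whose right-hand side
is nonincreasing in `w` and points into a funnel that closes as `u → 0` has a solution in this
funnel. -/
theorem exists_solution_in_funnel {f : ℝ → ℝ → ℝ} {φ ψ φ' ψ' : ℝ → ℝ} {ε : ℝ} (hε : 0 < ε)
    (hφ : ∀ u ∈ Ioc 0 ε, HasDerivAt φ (φ' u) u) (hψ : ∀ u ∈ Ioc 0 ε, HasDerivAt ψ (ψ' u) u)
    (hle : ∀ u ∈ Ioc 0 ε, φ u ≤ ψ u)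
    (hgap : Tendsto (fun u => ψ u - φ u) (𝓝[>] 0) (𝓝 0))
    (hf : ContinuousOn (fun p : ℝ × ℝ => f p.1 p.2)
      {p | p.1 ∈ Ioc 0 ε ∧ p.2 ∈ Icc (φ p.1) (ψ p.1)})
    (hlip : ∀ r ∈ Ioc 0 ε, ∃ K : NNReal, ∀ u ∈ Icc r ε,
      LipschitzOnWith K (f u) (Icc (φ u) (ψ u)))
    (hanti : ∀ u ∈ Ioc 0 ε, AntitoneOn (f u) (Icc (φ u) (ψ u)))
    (hlow : ∀ u ∈ Ioc 0 ε, φ' u < f u (φ u)) (hup : ∀ u ∈ Ioc 0 ε, f u (ψ u) < ψ' u) :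
    ∃ H : ℝ → ℝ, ∀ u ∈ Ioo 0 ε, H u ∈ Icc (φ u) (ψ u) ∧ HasDerivAt H (f u (H u)) u := by
  set r : ℕ → ℝ := fun n => ε / (n + 2) with hrdef
  have hr0 : ∀ n, 0 < r n := fun n => by positivity
  have hrε : ∀ n, r n ≤ ε := fun n => div_le_self hε.le (by linarith [n.cast_nonneg (α := ℝ)])
  have hrtend : Tendsto r atTop (𝓝[>] 0) := by
    refine tendsto_nhdsWithin_iff.2 ⟨?_, Eventually.of_forall hr0⟩
    exact tendsto_const_nhds.div_atTop
      (tendsto_atTop_add_const_right _ _ tendsto_natCast_atTop_atTop)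
  have hrmono : ∀ {m n}, n ≤ m → r m ≤ r n := fun {m n} h => by
    have : (n : ℝ) ≤ m := by exact_mod_cast h
    exact div_le_div_of_nonneg_left hε.le (by positivity) (by linarith)
  have hsub : ∀ s, 0 < s → Icc s ε ⊆ Ioc 0 ε := fun s hs u hu => ⟨hs.trans_le hu.1, hu.2⟩
  have key : ∀ n, ∃ w : ℝ → ℝ, ∀ u ∈ Icc (r n) ε, w u ∈ Icc (φ u) (ψ u) ∧
      HasDerivWithinAt w (f u (w u)) (Icc (r n) ε) u := by
    intro n
    obtain ⟨K, hK⟩ := hlip (r n) ⟨hr0 n, hrε n⟩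
    have hs := hsub (r n) (hr0 n)
    exact exists_solution_in_funnel_Icc (hrε n) (fun u hu => hφ u (hs hu))
      (fun u hu => hψ u (hs hu)) (fun u hu => hle u (hs hu))
      (hf.mono fun p hp => ⟨hs hp.1, hp.2⟩) hK (fun u hu => hanti u (hs hu))
      (fun u hu => hlow u (hs hu)) (fun u hu => hup u (hs hu))
  choose w hw using key
  set d : ℕ → ℝ := fun n => ψ (r n) - φ (r n)
  have hd0 : Tendsto d atTop (𝓝 0) := hgap.comp hrtend
  -- Since `f u` is nonincreasing, the squared difference of two solutions decreases in `u`. At `u =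
  -- r n` both lie in the funnel, whose width there is `d n`.
  have hclose : ∀ n m, n ≤ m → ∀ u ∈ Icc (r n) ε, |w n u - w m u| ≤ d n := by
    intro n m hnm u hu
    have hs : Icc (r n) ε ⊆ Icc (r m) ε := Icc_subset_Icc_left (hrmono hnm)
    have hder : ∀ u ∈ Icc (r n) ε, HasDerivWithinAt (fun u => (w n u - w m u) ^ 2)
        (2 * (w n u - w m u) * (f u (w n u) - f u (w m u))) (Icc (r n) ε) u := by
      intro u hu
      have h1 := ((hw n u hu).2.sub (((hw m u (hs hu)).2).mono hs)).pow 2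
      refine h1.congr_deriv ?_
      simp
    have hA : AntitoneOn (fun u => (w n u - w m u) ^ 2) (Icc (r n) ε) := by
      refine antitoneOn_of_hasDerivWithinAt_nonpos (convex_Icc _ _)
        (fun u hu => (hder u hu).continuousWithinAt)
        (fun u hu => (hder u (interior_subset hu)).mono interior_subset) (fun u hu => ?_)
      have hu' := interior_subset hu
      have h1 := (hw n u hu').1
      have h2 := (hw m u (hs hu')).1
      have h3 := hanti u (hsub _ (hr0 n) hu')
      rcases le_total (w n u) (w m u) with h | h
      · nlinarith [h3 h1 h2 h]
      · nlinarith [h3 h2 h1 h]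
    have h1 := hA (left_mem_Icc.2 (hrε n)) hu hu.1
    have h2 := (hw n (r n) (left_mem_Icc.2 (hrε n))).1
    have h3 := (hw m (r n) (hs (left_mem_Icc.2 (hrε n)))).1
    have h4 : |w n (r n) - w m (r n)| ≤ d n :=
      abs_le.2 ⟨by linarith [h2.1, h3.2], by linarith [h2.2, h3.1]⟩
    exact (sq_le_sq.1 h1).trans h4
  have hlim : ∀ u : ℝ, ∃ ℓ : ℝ, u ∈ Ioc 0 ε → Tendsto (fun n => w n u) atTop (𝓝 ℓ) := by
    intro u
    by_cases hu : u ∈ Ioc 0 ε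
    · obtain ⟨N, hN⟩ := eventually_atTop.1
        (((tendsto_nhdsWithin_iff.1 hrtend).1).eventually (gt_mem_nhds hu.1))
      have hC : CauchySeq fun n => w n u := by
        rw [Metric.cauchySeq_iff']
        intro e he
        obtain ⟨M, hM⟩ := eventually_atTop.1 (hd0.eventually (gt_mem_nhds he))
        refine ⟨max M N, fun m hm => ?_⟩
        rw [dist_comm, Real.dist_eq]
        exact (hclose _ m hm u ⟨(hN _ (le_max_right _ _)).le, hu.2⟩).trans_lt
          (hM _ (le_max_left _ _))
      obtain ⟨ℓ, hℓ⟩ := cauchySeq_tendsto_of_complete hC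
      exact ⟨ℓ, fun _ => hℓ⟩
    · exact ⟨0, fun h => absurd h hu⟩
  choose H hH using hlim
  have hHclose : ∀ n, ∀ u ∈ Icc (r n) ε, |w n u - H u| ≤ d n := by
    intro n u hu
    refine le_of_tendsto ((tendsto_const_nhds.sub (hH u (hsub _ (hr0 n) hu))).abs) ?_
    filter_upwards [eventually_ge_atTop n] with m hm
    exact hclose n m hm u hu
  have hHmem : ∀ u ∈ Ioc 0 ε, H u ∈ Icc (φ u) (ψ u) := by
    intro u hu
    refine isClosed_Icc.mem_of_tendsto (hH u hu) ?_
    filter_upwards [((tendsto_nhdsWithin_iff.1 hrtend).1).eventually (gt_mem_nhds hu.1)] with n hn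
    exact (hw n u ⟨hn.le, hu.2⟩).1
  refine ⟨H, fun u hu => ⟨hHmem u (Ioo_subset_Ioc_self hu), ?_⟩⟩
  obtain ⟨N, hN⟩ := eventually_atTop.1
    (((tendsto_nhdsWithin_iff.1 hrtend).1).eventually (gt_mem_nhds hu.1))
  obtain ⟨K, hK⟩ := hlip (r N) ⟨hr0 N, hrε N⟩
  -- Away from `u = 0` the Lipschitz bound turns uniform convergence of `w n` into uniform
  -- convergence of the derivatives, so the limit solves the equation.
  refine hasDerivAt_of_tendstoUniformlyOn (l := atTop) (s := Ioo (r N) ε) (f := w)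
    (f' := fun n u => f u (w n u)) (g' := fun u => f u (H u)) isOpen_Ioo ?_ ?_ ?_
    ⟨hN N le_rfl, hu.2⟩
  · rw [Metric.tendstoUniformlyOn_iff]
    intro e he
    have h1 : Tendsto (fun n => (K : ℝ) * d n) atTop (𝓝 0) := by
      simpa using hd0.const_mul (K : ℝ)
    filter_upwards [h1.eventually (gt_mem_nhds he), eventually_ge_atTop N] with n hn hNn s hs
    have hs' : s ∈ Icc (r n) ε := ⟨(hrmono hNn).trans hs.1.le, hs.2.le⟩
    have h2 := (hK s (Ioo_subset_Icc_self hs)).dist_le_mul _ (hHmem s (hsub _ (hr0 n) hs')) _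
      (hw n s hs').1
    refine h2.trans_lt (lt_of_le_of_lt ?_ hn)
    rw [dist_comm, Real.dist_eq]
    exact mul_le_mul_of_nonneg_left (hHclose n s hs') K.2
  · filter_upwards [eventually_ge_atTop N] with n hn s hs
    have hs' : s ∈ Ioo (r n) ε := ⟨(hrmono hn).trans_lt hs.1, hs.2⟩
    exact (hw n s (Ioo_subset_Icc_self hs')).2.hasDerivAt (Icc_mem_nhds hs'.1 hs'.2)
  · exact fun s hs => hH s ⟨(hr0 N).trans hs.1, hs.2.le⟩

/-! ### The field near `(0, 1)` -/

/-- In the coordinates `(x, 1 + w)` and with `u = x ^ 2` the first component of the field is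
`x * radialRate a u w`. -/
def radialRate (a u w : ℝ) : ℝ := (1 - a) + (1 - 2 * a) * w - a * w ^ 2 - a * u

/-- In the coordinates `(x, 1 + w)` and with `u = x ^ 2` the second component of the field is
`heightRate b u w`. -/
def heightRate (b u w : ℝ) : ℝ := -u * (1 + b * w) - b * w * (1 + w) ^ 2

/-- The factor `x` makes the `y`-axis invariant. Dependence on `x ^ 2` alone gives the reflection
symmetry in `x` and allows the unstable curve to be a graph over `u = x ^ 2`. -/
theorem cdkField_eq (a b x w : ℝ) :
    cdkField a b (x, 1 + w) = (x * radialRate a (x ^ 2) w, heightRate b (x ^ 2) w) := by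
  ext <;> simp only [cdkField, radialRate, heightRate] <;> ring

/-- The divided difference of `radialRate` in the second variable. -/
def radialSlope (a w₁ w₂ : ℝ) : ℝ := (1 - 2 * a) - a * (w₁ + w₂)

/-- The divided difference of `heightRate` in the second variable. -/
def heightSlope (b u w₁ w₂ : ℝ) : ℝ :=
  -b * u - b * (1 + 2 * (w₁ + w₂) + (w₁ ^ 2 + w₁ * w₂ + w₂ ^ 2))

theorem radialRate_sub (a u w₁ w₂ : ℝ) :
    radialRate a u w₁ - radialRate a u w₂ = (w₁ - w₂) * radialSlope a w₁ w₂ := by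
  simp only [radialRate, radialSlope]; ring

theorem heightRate_sub (b u w₁ w₂ : ℝ) :
    heightRate b u w₁ - heightRate b u w₂ = (w₁ - w₂) * heightSlope b u w₁ w₂ := by
  simp only [heightRate, heightSlope]; ring

@[fun_prop]
theorem Continuous.radialRate {X : Type*} [TopologicalSpace X] (a : ℝ) {u w : X → ℝ}
    (hu : Continuous u) (hw : Continuous w) : Continuous fun t => radialRate a (u t) (w t) := by
  unfold _root_.radialRate; fun_prop

@[fun_prop]
theorem Continuous.heightRate {X : Type*} [TopologicalSpace X] (b : ℝ) {u w : X → ℝ}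
    (hu : Continuous u) (hw : Continuous w) : Continuous fun t => heightRate b (u t) (w t) := by
  unfold _root_.heightRate; fun_prop

/-! ### The unstable curve of the saddle -/

theorem abs_le_of_mem_funnel {c K u w : ℝ} (hu : 0 < u) (hc : 0 < c) (hKu : K * u ≤ 1)
    (hw : |w + c * u| ≤ K * u ^ 2) : |w| ≤ (c + 1) * u := by
  rw [abs_le] at hw ⊢
  have : K * u ^ 2 ≤ u := by nlinarith
  have := mul_pos hc hu
  constructor <;> linarith [hw.1, hw.2]

/-- Here `radialRate` is close to `1 - a > 0`, while `heightRate` is `O(u)` because `w = O(u)` in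
the funnel. The second estimate later bounds the slope of the invariant curve and makes the quotient
of the rates monotone in `w`. -/
theorem radialRate_funnel_of_lt_one {a b : ℝ} (ha : 0 < a) (hb : 0 < b) (ha1 : a < 1) {c K : ℝ}
    (hc : 0 < c) : ∃ m > 0, ∃ C > 0, ∀ᶠ u in 𝓝[>] (0 : ℝ), ∀ w, |w + c * u| ≤ K * u ^ 2 →
      m * u ≤ radialRate a u w ∧ |heightRate b u w| ≤ C * u * radialRate a u w := by
  set C₀ := 1 + b + 4 * b * (c + 1) with hC₀
  have hC₀pos : 0 < C₀ := by positivity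
  refine ⟨(1 - a) / 2, by linarith, 2 * C₀ / (1 - a), div_pos (by linarith) (by linarith), ?_⟩
  have e1 : ∀ᶠ u in 𝓝[>] (0 : ℝ), K * u < 1 :=
    nhdsWithin_le_nhds ((by fun_prop : Continuous fun u : ℝ => K * u).tendsto' 0 0 (by simp)
      |>.eventually (gt_mem_nhds one_pos))
  have e2 : ∀ᶠ u in 𝓝[>] (0 : ℝ), (c + 1) * u < (1 - a) / 8 :=
    nhdsWithin_le_nhds ((by fun_prop : Continuous fun u : ℝ => (c + 1) * u).tendsto' 0 0 (by simp)
      |>.eventually (gt_mem_nhds (by linarith)))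
  filter_upwards [e1, e2, self_mem_nhdsWithin] with u h1 h2 hu w hw
  have hu : 0 < u := hu
  have hw1 := abs_le_of_mem_funnel hu hc h1.le hw
  have hw2 : |w| ≤ (1 - a) / 8 := hw1.trans h2.le
  have hw3 := abs_le.1 hw2
  have hu2 : u ≤ (1 - a) / 8 := by nlinarith
  have hg : (1 - a) / 2 ≤ radialRate a u w := by
    simp only [radialRate]
    nlinarith
  refine ⟨by nlinarith, ?_⟩
  have hG : |heightRate b u w| ≤ C₀ * u := by
    have hw4 : |1 + b * w| ≤ 1 + b := by
      rw [abs_le]; constructor <;> nlinarith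
    have hw5 : (1 + w) ^ 2 ≤ 4 := by nlinarith
    calc |heightRate b u w| ≤ |-u * (1 + b * w)| + |b * w * (1 + w) ^ 2| := abs_sub _ _
      _ = u * |1 + b * w| + b * |w| * (1 + w) ^ 2 := by
        rw [abs_mul, abs_neg, abs_of_pos hu, abs_mul, abs_mul, abs_of_pos hb, abs_of_nonneg
          (sq_nonneg (1 + w))]
      _ ≤ u * (1 + b) + b * ((c + 1) * u) * 4 := by gcongr
      _ = C₀ * u := by rw [hC₀]; ring
  have h6 : C₀ * u = 2 * C₀ / (1 - a) * u * ((1 - a) / 2) := by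
    have : 1 - a ≠ 0 := by linarith
    field_simp
  have h7 : 0 ≤ 2 * C₀ / (1 - a) * u :=
    mul_nonneg (div_nonneg (by linarith) (by linarith)) hu.le
  calc _ ≤ C₀ * u := hG
    _ = _ := h6
    _ ≤ _ := mul_le_mul_of_nonneg_left hg h7

/-- Now `radialRate` is only about `(c - 1) u`, so `heightRate` has to be `O(u ^ 2)`. It is, because
`b c = 1` cancels the first-order part of `-u - b w` on `w = -c u + O(u ^ 2)`. -/
theorem radialRate_funnel_of_eq_one {b : ℝ} (hb : 0 < b) {c K : ℝ}
    (hc : 1 < c) (hbc : b * c = 1) (hK : 0 < K) :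
    ∃ m > 0, ∃ C > 0, ∀ᶠ u in 𝓝[>] (0 : ℝ), ∀ w, |w + c * u| ≤ K * u ^ 2 →
      m * u ≤ radialRate 1 u w ∧ |heightRate b u w| ≤ C * u * radialRate 1 u w := by
  set C₀ := b * K + b * (c + 1) + 3 * b * (c + 1) ^ 2 with hC₀
  have hC₀pos : 0 < C₀ := by positivity
  refine ⟨(c - 1) / 2, by linarith, 2 * C₀ / (c - 1), div_pos (by linarith) (by linarith), ?_⟩
  have e1 : ∀ᶠ u in 𝓝[>] (0 : ℝ), K * u < 1 :=
    nhdsWithin_le_nhds ((by fun_prop : Continuous fun u : ℝ => K * u).tendsto' 0 0 (by simp)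
      |>.eventually (gt_mem_nhds one_pos))
  have e2 : ∀ᶠ u in 𝓝[>] (0 : ℝ), (c + 1) * u < 1 :=
    nhdsWithin_le_nhds ((by fun_prop : Continuous fun u : ℝ => (c + 1) * u).tendsto' 0 0 (by simp)
      |>.eventually (gt_mem_nhds one_pos))
  have e3 : ∀ᶠ u in 𝓝[>] (0 : ℝ), (K + (c + 1) ^ 2) * u < (c - 1) / 2 :=
    nhdsWithin_le_nhds ((by fun_prop : Continuous fun u : ℝ => (K + (c + 1) ^ 2) * u).tendsto' 0 0
      (by simp) |>.eventually (gt_mem_nhds (by linarith)))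
  filter_upwards [e1, e2, e3, self_mem_nhdsWithin] with u h1 h2 h3 hu w hw
  have hu : 0 < u := hu
  have hw1 := abs_le_of_mem_funnel hu (by linarith) h1.le hw
  have hw2 : |w| ≤ 1 := hw1.trans h2.le
  have hwsq : w ^ 2 ≤ (c + 1) ^ 2 * u ^ 2 := by
    rw [← mul_pow, ← sq_abs w]
    gcongr
  have hg : (c - 1) / 2 * u ≤ radialRate 1 u w := by
    simp only [radialRate]
    have := (abs_le.1 hw).2
    nlinarith
  refine ⟨hg, ?_⟩
  have hG : |heightRate b u w| ≤ C₀ * u ^ 2 := by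
    have e : heightRate b u w = -(b * (w + c * u)) - b * u * w - b * w ^ 2 * (2 + w) := by
      simp only [heightRate]
      linear_combination u * hbc
    have h4 : |2 + w| ≤ 3 := by rw [abs_le] at hw2 ⊢; constructor <;> linarith
    calc |heightRate b u w|
        ≤ |-(b * (w + c * u)) - b * u * w| + |b * w ^ 2 * (2 + w)| := by rw [e]; exact abs_sub _ _
      _ ≤ |-(b * (w + c * u))| + |b * u * w| + |b * w ^ 2 * (2 + w)| := by
        gcongr; exact abs_sub _ _
      _ = b * |w + c * u| + b * u * |w| + b * w ^ 2 * |2 + w| := by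
        simp only [abs_neg, abs_mul, abs_of_pos hb, abs_of_pos hu, abs_pow, sq_abs]
      _ ≤ b * (K * u ^ 2) + b * u * ((c + 1) * u) + b * ((c + 1) ^ 2 * u ^ 2) * 3 := by gcongr
      _ = C₀ * u ^ 2 := by rw [hC₀]; ring
  have h6 : C₀ * u ^ 2 = 2 * C₀ / (c - 1) * u * ((c - 1) / 2 * u) := by
    have : c - 1 ≠ 0 := by linarith
    field_simp
  have h7 : 0 ≤ 2 * C₀ / (c - 1) * u :=
    mul_nonneg (div_nonneg (by linarith) (by linarith)) hu.le
  calc _ ≤ C₀ * u ^ 2 := hG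
    _ = _ := h6
    _ ≤ _ := mul_le_mul_of_nonneg_left hg h7

/-- The field crosses the boundary curves `w = -c u + κ u ^ 2` in the direction determined by the
sign of `κ`, if `|κ|` is large. -/
theorem exists_boundary_expansion {a b c : ℝ} (hc : c * (b + 2 * (1 - a)) = 1) :
    ∃ C₀ : ℝ, ∀ κ : ℝ, ∃ R : ℝ → ℝ, Continuous R ∧ R 0 = C₀ - κ * (b + 4 * (1 - a)) ∧
      ∀ u, heightRate b u (-c * u + κ * u ^ 2) -
        (-c + 2 * κ * u) * (2 * u * radialRate a u (-c * u + κ * u ^ 2)) = u ^ 2 * R u := by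
  refine ⟨b * c - 2 * b * c ^ 2 - 2 * c * ((1 - 2 * a) * c + a), fun κ =>
    ⟨fun u => -b * (-c + κ * u) - b * κ - 2 * b * (-c + κ * u) ^ 2
      - b * u * (-c + κ * u) ^ 3 - 4 * κ * (1 - a) - 2 * (-c + 2 * κ * u) *
        ((1 - 2 * a) * (-c + κ * u) - a * u * (-c + κ * u) ^ 2 - a), by fun_prop, by ring, ?_⟩⟩
  intro u
  simp only [heightRate, radialRate]
  -- The condition on `c` says exactly that the terms of first order in `u` cancel along `w = -c u`.
  linear_combination u * hc

/-- The quotient of the two components of the field is nonincreasing and Lipschitz in the second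
variable where `heightRate` is small relative to `radialRate`. -/
theorem exists_slope_bound {a b m C u w₁ w₂ : ℝ} (ha : 0 ≤ a) (ha1 : a ≤ 1) (hb : 0 < b)
    (hm : 0 < m) (hu : 0 < u) (hu' : u ≤ 1 / 16) (hw₁ : |w₁| ≤ 1 / 16) (hw₂ : |w₂| ≤ 1 / 16)
    (hC : 3 * C * u ≤ b / 4) (hg₁ : m * u ≤ radialRate a u w₁) (hg₂ : 0 < radialRate a u w₂)
    (hG₂ : |heightRate b u w₂| ≤ C * u * radialRate a u w₂) :
    ∃ Q, 0 ≤ Q ∧ Q ≤ 3 * b / (2 * m * u ^ 2) ∧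
      heightRate b u w₁ / (2 * u * radialRate a u w₁) -
        heightRate b u w₂ / (2 * u * radialRate a u w₂) = -((w₁ - w₂) * Q) := by
  have hw₁' := abs_le.1 hw₁
  have hw₂' := abs_le.1 hw₂
  have hA : |radialSlope a w₁ w₂| ≤ 3 := by
    have h1 : |a * (w₁ + w₂)| ≤ 1 := by
      rw [abs_mul, abs_of_nonneg ha]
      exact mul_le_one₀ ha1 (abs_nonneg _) (abs_le.2 ⟨by linarith, by linarith⟩)
    have h2 := abs_le.1 h1
    simp only [radialSlope, abs_le]
    constructor <;> linarith
  have hsq₁ : w₁ ^ 2 ≤ 1 / 16 := by nlinarith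
  have hsq₂ : w₂ ^ 2 ≤ 1 / 16 := by nlinarith
  have hquad : w₁ ^ 2 + w₁ * w₂ + w₂ ^ 2 ≤ 1 / 4 := by nlinarith [sq_nonneg (w₁ - w₂)]
  have hquad' : 0 ≤ w₁ ^ 2 + w₁ * w₂ + w₂ ^ 2 := by nlinarith [sq_nonneg (w₁ + w₂)]
  have hB : heightSlope b u w₁ w₂ ≤ -(b / 2) := by
    have : b * (1 / 2) ≤ b * (u + (1 + 2 * (w₁ + w₂) + (w₁ ^ 2 + w₁ * w₂ + w₂ ^ 2))) :=
      mul_le_mul_of_nonneg_left (by linarith) hb.le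
    simp only [heightSlope]; linarith
  have hB' : -(2 * b) ≤ heightSlope b u w₁ w₂ := by
    have : b * (u + (1 + 2 * (w₁ + w₂) + (w₁ ^ 2 + w₁ * w₂ + w₂ ^ 2))) ≤ b * 2 :=
      mul_le_mul_of_nonneg_left (by linarith) hb.le
    simp only [heightSlope]; linarith
  have h6 := radialRate_sub a u w₁ w₂
  have h7 := heightRate_sub b u w₁ w₂
  generalize radialRate a u w₁ = g₁ at *
  generalize radialRate a u w₂ = g₂ at *
  generalize heightRate b u w₁ = G₁ at *
  generalize heightRate b u w₂ = G₂ at *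
  generalize heightSlope b u w₁ w₂ = S at *
  generalize radialSlope a w₁ w₂ = A at *
  -- Over a common denominator the difference of quotients has numerator `(w₁ - w₂) * (S g₂ - G₂
  -- A)`. The term `S g₂ ≤ -(b / 2) g₂` dominates `|G₂ A| ≤ (b / 4) g₂`, which fixes the sign.
  have hg₁' : 0 < g₁ := (mul_pos hm hu).trans_le hg₁
  have hprod : |G₂ * A| ≤ b / 4 * g₂ := by
    rw [abs_mul]
    calc |G₂| * |A| ≤ C * u * g₂ * 3 :=
          mul_le_mul hG₂ hA (abs_nonneg _) ((abs_nonneg _).trans hG₂)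
      _ = 3 * C * u * g₂ := by ring
      _ ≤ b / 4 * g₂ := mul_le_mul_of_nonneg_right hC hg₂.le
  have hprod' := abs_le.1 hprod
  have hS := mul_le_mul_of_nonneg_right hB hg₂.le
  have hS' := mul_le_mul_of_nonneg_right hB' hg₂.le
  have hbg := mul_pos hb hg₂
  have hneg : 0 ≤ -(S * g₂ - G₂ * A) := by linarith
  have hlow : -(S * g₂ - G₂ * A) ≤ 3 * b * g₂ := by linarith
  have hden : 0 < 2 * u * g₁ * g₂ := by positivity
  refine ⟨-(S * g₂ - G₂ * A) / (2 * u * g₁ * g₂), div_nonneg hneg hden.le, ?_, ?_⟩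
  · rw [div_le_div_iff₀ hden (by positivity)]
    calc -(S * g₂ - G₂ * A) * (2 * m * u ^ 2)
        ≤ 3 * b * g₂ * (2 * m * u ^ 2) := by gcongr
      _ = 3 * b * g₂ * (2 * u * (m * u)) := by ring
      _ ≤ 3 * b * g₂ * (2 * u * g₁) := by gcongr
      _ = 3 * b * (2 * u * g₁ * g₂) := by ring
  · rw [div_sub_div _ _ (by positivity) (by positivity)]
    rw [← mul_div_assoc, ← neg_div, div_eq_div_iff (by positivity) (by positivity)]
    linear_combination (2 * u * g₁ * g₂) * (2 * u) * (g₂ * h7 - G₂ * h6)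

/-- The invariant curve through the saddle, as a graph over `u = x ^ 2`. -/
theorem exists_graph_over_sq {a b : ℝ} (ha : 0 < a) (hb : 0 < b)
    (hab : a < 1 ∨ a = 1 ∧ b < 1) :
    ∃ ε > 0, ∃ C > 0, ∃ H : ℝ → ℝ, ∀ u ∈ Ioo 0 ε, |H u| ≤ C * u ∧
      0 < radialRate a u (H u) ∧
      |heightRate b u (H u)| ≤ C * u * radialRate a u (H u) ∧
      HasDerivAt H (heightRate b u (H u) / (2 * u * radialRate a u (H u))) u := by
  have ha1 : a ≤ 1 := by rcases hab with h | h <;> linarith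
  have hq : 0 < b + 2 * (1 - a) := by linarith
  set c := 1 / (b + 2 * (1 - a)) with hcdef
  have hc : c * (b + 2 * (1 - a)) = 1 := by rw [hcdef]; field_simp
  have hcpos : 0 < c := by positivity
  obtain ⟨C₀, hR⟩ := exists_boundary_expansion hc
  -- Chosen so that `R₁ 0 ≤ -1` and `R₂ 0 ≥ 1`: `C₀` does not depend on `κ`, and `K * (b + 4 * (1 -
  -- a)) ≥ |C₀| + 1`.
  set K := (|C₀| + 1) / b with hK
  have hKpos : 0 < K := by positivity
  have hKb : K * b = |C₀| + 1 := by rw [hK]; field_simp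
  have hKa : 0 ≤ K * (1 - a) := mul_nonneg hKpos.le (by linarith)
  obtain ⟨R₁, hR₁, hR₁0, hR₁e⟩ := hR K
  obtain ⟨R₂, hR₂, hR₂0, hR₂e⟩ := hR (-K)
  have hest : ∃ m > 0, ∃ C > 0, ∀ᶠ u in 𝓝[>] (0 : ℝ), ∀ w, |w + c * u| ≤ K * u ^ 2 →
      m * u ≤ radialRate a u w ∧ |heightRate b u w| ≤ C * u * radialRate a u w := by
    rcases hab with h | ⟨rfl, h⟩
    · exact radialRate_funnel_of_lt_one ha hb h hcpos
    · refine radialRate_funnel_of_eq_one hb ?_ (by linarith) hKpos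
      have h1 : b * c = 1 := by linarith
      nlinarith
  obtain ⟨m, hm, C, hC, hest⟩ := hest
  have e1 : ∀ᶠ u in 𝓝[>] (0 : ℝ), R₁ u < 0 := by
    refine nhdsWithin_le_nhds (hR₁.continuousAt.eventually (gt_mem_nhds ?_))
    rw [hR₁0]
    linarith [le_abs_self C₀]
  have e2 : ∀ᶠ u in 𝓝[>] (0 : ℝ), 0 < R₂ u := by
    refine nhdsWithin_le_nhds (hR₂.continuousAt.eventually (lt_mem_nhds ?_))
    rw [hR₂0]
    linarith [neg_abs_le C₀]
  have e3 : ∀ᶠ u in 𝓝[>] (0 : ℝ), K * u < 1 :=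
    nhdsWithin_le_nhds ((by fun_prop : Continuous fun u : ℝ => K * u).tendsto' 0 0 (by simp)
      |>.eventually (gt_mem_nhds one_pos))
  have e4 : ∀ᶠ u in 𝓝[>] (0 : ℝ), (c + 1) * u < 1 / 16 :=
    nhdsWithin_le_nhds ((by fun_prop : Continuous fun u : ℝ => (c + 1) * u).tendsto' 0 0 (by simp)
      |>.eventually (gt_mem_nhds (by norm_num)))
  have e5 : ∀ᶠ u in 𝓝[>] (0 : ℝ), 3 * C * u < b / 4 :=
    nhdsWithin_le_nhds ((by fun_prop : Continuous fun u : ℝ => 3 * C * u).tendsto' 0 0 (by simp)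
      |>.eventually (gt_mem_nhds (by linarith)))
  obtain ⟨ε, hε, hall⟩ := mem_nhdsGT_iff_exists_Ioc_subset.1
    (hest.and (e1.and (e2.and (e3.and (e4.and e5)))))
  have hε : 0 < ε := hε
  set φ : ℝ → ℝ := fun u => -c * u + -K * u ^ 2 with hφ
  set ψ : ℝ → ℝ := fun u => -c * u + K * u ^ 2 with hψ
  have hmem : ∀ u w, w ∈ Icc (φ u) (ψ u) ↔ |w + c * u| ≤ K * u ^ 2 := by
    intro u w
    simp only [hφ, hψ, mem_Icc, abs_le]
    constructor <;> rintro ⟨h1, h2⟩ <;> constructor <;> linarith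
  have hle : ∀ u, φ u ≤ ψ u := fun u => by
    have := mul_nonneg hKpos.le (sq_nonneg u)
    simp only [hφ, hψ]; linarith
  have hder : ∀ κ u : ℝ, HasDerivAt (fun u => -c * u + κ * u ^ 2) (-c + 2 * κ * u) u := by
    intro κ u
    have := ((hasDerivAt_id u).const_mul (-c)).fun_add (((hasDerivAt_id u).pow 2).const_mul κ)
    simp only [id, Pi.pow_apply] at this
    exact this.congr_deriv (by simp; ring)
  have hgpos : ∀ u ∈ Ioc 0 ε, ∀ w ∈ Icc (φ u) (ψ u), 0 < radialRate a u w := fun u hu w hw =>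
    (mul_pos hm hu.1).trans_le ((hall hu).1 w ((hmem u w).1 hw)).1
  have hdiff : ∀ u ∈ Ioc 0 ε, ∀ w₁ ∈ Icc (φ u) (ψ u), ∀ w₂ ∈ Icc (φ u) (ψ u), ∃ Q,
      0 ≤ Q ∧ Q ≤ 3 * b / (2 * m * u ^ 2) ∧
      heightRate b u w₁ / (2 * u * radialRate a u w₁) -
        heightRate b u w₂ / (2 * u * radialRate a u w₂) = -((w₁ - w₂) * Q) := by
    intro u hu w₁ h₁ w₂ h₂
    obtain ⟨hes, -, -, hu1, hu2, hu3⟩ := hall hu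
    rw [hmem] at h₁ h₂
    have hu0 := hu.1
    exact exists_slope_bound ha.le ha1 hb hm hu0 (by nlinarith)
      ((abs_le_of_mem_funnel hu0 hcpos hu1.le h₁).trans hu2.le)
      ((abs_le_of_mem_funnel hu0 hcpos hu1.le h₂).trans hu2.le) hu3.le (hes w₁ h₁).1
      ((mul_pos hm hu0).trans_le (hes w₂ h₂).1) (hes w₂ h₂).2
  set f : ℝ → ℝ → ℝ := fun u w => heightRate b u w / (2 * u * radialRate a u w) with hf
  have hcont : ContinuousOn (fun p : ℝ × ℝ => f p.1 p.2)
      {p | p.1 ∈ Ioc 0 ε ∧ p.2 ∈ Icc (φ p.1) (ψ p.1)} := by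
    refine ContinuousOn.div (Continuous.continuousOn (by fun_prop))
      (Continuous.continuousOn (by fun_prop)) ?_
    rintro ⟨u, w⟩ ⟨hu, hw⟩
    have h1 := hgpos u hu w hw
    have h2 := hu.1
    simp only at h2 ⊢
    positivity
  have hlip : ∀ r ∈ Ioc 0 ε, ∃ K : NNReal, ∀ u ∈ Icc r ε,
      LipschitzOnWith K (f u) (Icc (φ u) (ψ u)) := by
    intro r hr
    refine ⟨(3 * b / (2 * m * r ^ 2)).toNNReal, fun u hu => LipschitzOnWith.of_dist_le_mul ?_⟩
    intro w₁ h₁ w₂ h₂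
    obtain ⟨Q, hQ0, hQ1, hQ⟩ := hdiff u ⟨hr.1.trans_le hu.1, hu.2⟩ w₁ h₁ w₂ h₂
    have hr0 := hr.1
    simp only [hf]
    rw [Real.dist_eq, Real.dist_eq, hQ, abs_neg, abs_mul, mul_comm, abs_of_nonneg hQ0,
      Real.coe_toNNReal _ (by positivity)]
    refine mul_le_mul_of_nonneg_right (hQ1.trans ?_) (abs_nonneg _)
    gcongr
    exact hu.1
  have hanti : ∀ u ∈ Ioc 0 ε, AntitoneOn (f u) (Icc (φ u) (ψ u)) := by
    intro u hu w₁ h₁ w₂ h₂ h12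
    obtain ⟨Q, hQ0, -, hQ⟩ := hdiff u hu w₁ h₁ w₂ h₂
    simp only [hf]
    nlinarith
  have hlow : ∀ u ∈ Ioc 0 ε, -c + 2 * -K * u < f u (φ u) := by
    intro u hu
    have h1 := hgpos u hu _ (left_mem_Icc.2 (hle u))
    have h2 := hu.1
    simp only [hf]
    rw [lt_div_iff₀ (by positivity)]
    have h3 := hR₂e u
    have h4 := mul_pos (pow_pos h2 2) (hall hu).2.2.1
    simp only [hφ]
    linarith
  have hup : ∀ u ∈ Ioc 0 ε, f u (ψ u) < -c + 2 * K * u := by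
    intro u hu
    have h1 := hgpos u hu _ (right_mem_Icc.2 (hle u))
    have h2 := hu.1
    simp only [hf]
    rw [div_lt_iff₀ (by positivity)]
    have h3 := hR₁e u
    have h4 := mul_neg_of_pos_of_neg (pow_pos h2 2) (hall hu).2.1
    simp only [hψ]
    linarith
  obtain ⟨H, hH⟩ := exists_solution_in_funnel
    (f := f) (φ := φ) (ψ := ψ)
    (φ' := fun u => -c + 2 * -K * u) (ψ' := fun u => -c + 2 * K * u) hε
    (fun u _ => hder (-K) u) (fun u _ => hder K u) (fun u _ => hle u)
    (((by fun_prop : Continuous fun u : ℝ => ψ u - φ u).tendsto' 0 0 (by simp [hφ, hψ])).mono_left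
      nhdsWithin_le_nhds)
    hcont hlip hanti hlow hup
  refine ⟨ε, hε, max C (c + 1), lt_max_of_lt_left hC, H, fun u hu => ?_⟩
  have hu' := Ioo_subset_Ioc_self hu
  obtain ⟨h1, h2⟩ := hH u hu
  have hg := hgpos u hu' _ h1
  refine ⟨?_, hg, ?_, h2⟩
  · refine (abs_le_of_mem_funnel hu.1 hcpos (hall hu').2.2.2.1.le ((hmem _ _).1 h1)).trans ?_
    exact mul_le_mul_of_nonneg_right (le_max_right _ _) hu.1.le
  · refine ((hall hu').1 _ ((hmem _ _).1 h1)).2.trans ?_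
    have := hu.1
    gcongr
    exact le_max_left _ _

/-- The invariant curve through the saddle is the graph of a `C¹` function with vanishing derivative
at the origin, and the field points away from the saddle along it. -/
theorem exists_invariant_graph {a b : ℝ} (ha : 0 < a) (hb : 0 < b)
    (hab : a < 1 ∨ a = 1 ∧ b < 1) :
    ∃ ε > 0, ∃ h h' : ℝ → ℝ, h 0 = 0 ∧ h' 0 = 0 ∧ ContinuousOn h' (Ioo (-ε) ε) ∧
      ∀ x ∈ Ioo (-ε) ε, HasDerivAt h (h' x) x ∧
        heightRate b (x ^ 2) (h x) = h' x * (x * radialRate a (x ^ 2) (h x)) ∧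
        (x ≠ 0 → 0 < radialRate a (x ^ 2) (h x)) := by
  obtain ⟨ε₀, hε₀, C, hC, H, hH⟩ := exists_graph_over_sq ha hb hab
  -- The bound `1` ensures `x ^ 2 ≤ |x| < ε₀`.
  set ε := min 1 ε₀ with hε
  have hεpos : 0 < ε := lt_min one_pos hε₀
  set h : ℝ → ℝ := fun x => if x = 0 then 0 else H (x ^ 2) with hh
  set h' : ℝ → ℝ := fun x => heightRate b (x ^ 2) (h x) / (x * radialRate a (x ^ 2) (h x)) with hh'
  have hmem : ∀ x ∈ Ioo (-ε) ε, x ≠ 0 → x ^ 2 ∈ Ioo 0 ε₀ := by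
    intro x hx hx0
    refine ⟨by positivity, ?_⟩
    have h1 : |x| < ε := abs_lt.2 hx
    have h2 : |x| < 1 := h1.trans_le (min_le_left _ _)
    have h3 : |x| < ε₀ := h1.trans_le (min_le_right _ _)
    rw [← sq_abs]
    nlinarith [abs_nonneg x]
  have hne : ∀ x, x ≠ 0 → h x = H (x ^ 2) := fun x hx => if_neg hx
  have hder : ∀ x ∈ Ioo (-ε) ε, x ≠ 0 → HasDerivAt h (h' x) x := by
    intro x hx hx0
    obtain ⟨-, hg, -, hd⟩ := hH _ (hmem x hx hx0)
    have h1 : HasDerivAt (fun x => H (x ^ 2)) (h' x) x := by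
      have h2 := HasDerivAt.comp x (h := fun x : ℝ => x ^ 2) hd (hasDerivAt_pow 2 x)
      refine h2.congr_deriv ?_
      simp only [hh', hne x hx0]
      field_simp
      push_cast
      ring
    refine h1.congr_of_eventuallyEq ?_
    filter_upwards [isOpen_ne.mem_nhds hx0] with y hy
    exact hne y hy
  have hbound : ∀ x ∈ Ioo (-ε) ε, |h' x| ≤ C * |x| := by
    intro x hx
    rcases eq_or_ne x 0 with rfl | hx0
    · simp [hh']
    obtain ⟨-, hg, hG, -⟩ := hH _ (hmem x hx hx0)
    have h1 : 0 < |x| := abs_pos.2 hx0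
    simp only [hh', hne x hx0]
    rw [abs_div, abs_mul, abs_of_pos hg, div_le_iff₀ (by positivity)]
    refine hG.trans (le_of_eq ?_)
    rw [← sq_abs x]; ring
  have hh0 : h 0 = 0 := if_pos rfl
  have hh'0 : h' 0 = 0 := by simp [hh']
  -- The formula for `h'` is `0 / 0` at the origin, with default value `0`. That this is the
  -- derivative follows from `h x = O(x ^ 2)`.
  have hder0 : HasDerivAt h 0 0 := by
    have hO : h =O[𝓝 0] fun x => x ^ 2 := by
      refine Asymptotics.IsBigO.of_bound C ?_
      filter_upwards [Ioo_mem_nhds (neg_lt_zero.2 hεpos) hεpos] with x hx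
      rcases eq_or_ne x 0 with rfl | hx0
      · simp [hh0]
      rw [hne x hx0, Real.norm_eq_abs, Real.norm_of_nonneg (sq_nonneg x)]
      exact (hH _ (hmem x hx hx0)).1
    rw [hasDerivAt_iff_isLittleO]
    simp only [hh0, sub_zero, smul_zero]
    refine hO.trans_isLittleO ?_
    simpa using Asymptotics.isLittleO_pow_pow (𝕜 := ℝ) (m := 1) (n := 2) one_lt_two
  refine ⟨ε, hεpos, h, h', hh0, hh'0, ?_, ?_⟩
  · intro x hx
    refine ContinuousAt.continuousWithinAt ?_
    rcases eq_or_ne x 0 with rfl | hx0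
    · have hz : Tendsto (fun x : ℝ => C * |x|) (𝓝 0) (𝓝 0) :=
        (by fun_prop : Continuous fun x : ℝ => C * |x|).tendsto' 0 0 (by simp)
      rw [ContinuousAt, hh'0]
      refine squeeze_zero_norm' ?_ hz
      filter_upwards [Ioo_mem_nhds hx.1 hx.2] with y hy
      exact hbound y hy
    · have hhc : ContinuousAt h x := (hder x hx hx0).continuousAt
      have hg := (hH _ (hmem x hx hx0)).2.1
      have h1 : ContinuousAt (fun x : ℝ => (x ^ 2, h x)) x :=
        (continuous_pow 2).continuousAt.prodMk hhc
      have hG : ContinuousAt (fun x : ℝ => heightRate b (x ^ 2) (h x)) x :=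
        (show Continuous fun p : ℝ × ℝ => heightRate b p.1 p.2 by fun_prop).continuousAt.comp
          (f := fun x : ℝ => (x ^ 2, h x)) h1
      have hR : ContinuousAt (fun x : ℝ => radialRate a (x ^ 2) (h x)) x :=
        (show Continuous fun p : ℝ × ℝ => radialRate a p.1 p.2 by fun_prop).continuousAt.comp
          (f := fun x : ℝ => (x ^ 2, h x)) h1
      refine hG.div (continuousAt_id.mul hR) ?_
      rw [← hne x hx0] at hg
      exact mul_ne_zero hx0 hg.ne'
  · intro x hx
    rcases eq_or_ne x 0 with rfl | hx0
    · exact ⟨by rwa [hh'0], by simp [hh0, heightRate], fun h => absurd rfl h⟩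
    · have hg := (hH _ (hmem x hx hx0)).2.1
      rw [← hne x hx0] at hg
      refine ⟨hder x hx hx0, ?_, fun _ => hg⟩
      simp only [hh']
      field_simp

/-! ### Invariant curves -/

/-- A solution along a curve `k` whose tangent vectors are parallel to the field: if
`X s • k' s = F (k s)` with `X` vanishing at `0` and negative on `(0, δ]`, then the trajectory
through `k δ` sweeps out the arc `k '' (0, δ]` and tends to `k 0`. -/
theorem exists_solution_on_curve {F : ℝ × ℝ → ℝ × ℝ} {k k' : ℝ → ℝ × ℝ} {X : ℝ → ℝ} {δ : ℝ}
    (hδ : 0 < δ) {K : NNReal} (hX : LipschitzOnWith K X (Icc 0 δ)) (h0 : X 0 = 0)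
    (hneg : ∀ s ∈ Ioc 0 δ, X s < 0) (hk : ∀ s ∈ Icc 0 δ, HasDerivAt k (k' s) s)
    (hF : ∀ s ∈ Icc 0 δ, X s • k' s = F (k s)) :
    ∃ γ, IsForwardSolution F γ ∧ γ 0 = k δ ∧ γ '' Ici 0 = k '' Ioc 0 δ ∧
      Tendsto γ atTop (𝓝 (k 0)) := by
  obtain ⟨y, hy0, hy, hlim, him⟩ := exists_scalar_solution hδ hX h0 hneg
  refine ⟨k ∘ y, ?_, by simp [hy0], by rw [image_comp, him],
    (hk 0 ⟨le_rfl, hδ.le⟩).continuousAt.tendsto.comp hlim⟩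
  intro t ht
  have hmem : y t ∈ Icc 0 δ := Ioc_subset_Icc_self (him ▸ mem_image_of_mem y ht)
  have := (hk _ hmem).scomp_hasDerivWithinAt t (hy t ht)
  rwa [hF _ hmem] at this

/-- The point `p` lies on the curve `k`, which consists near `p` of two trajectories that tend to
`p` in forward time, and no other trajectory stays in the neighbourhood `U` of `p`. -/
structure IsStableCurve (F : ℝ × ℝ → ℝ × ℝ) (p : ℝ × ℝ) (k : ℝ → ℝ × ℝ) (ε : ℝ)
    (U : Set (ℝ × ℝ)) : Prop where
  pos : 0 < ε
  apply_zero : k 0 = p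
  stationary : F p = 0
  mem_nhds : U ∈ 𝓝 p
  continuousAt : ContinuousAt k 0
  half : ∀ σ : ℝ, (σ = 1 ∨ σ = -1) → ∀ δ ∈ Ioo 0 ε, ∃ γ, IsForwardSolution F γ ∧
    γ 0 = k (σ * δ) ∧ γ '' Ici 0 = (fun s => k (σ * s)) '' Ioc 0 δ ∧ Tendsto γ atTop (𝓝 p)
  trapped : forwardTrapped F U ⊆ k '' Ioo (-ε) ε

theorem forwardTrapped_mono {F : ℝ × ℝ → ℝ × ℝ} {M N : Set (ℝ × ℝ)} (h : M ⊆ N) :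
    forwardTrapped F M ⊆ forwardTrapped F N := fun _ ⟨γ, h1, h2, h3⟩ =>
  ⟨γ, h1, h2, fun t ht => h (h3 t ht)⟩

theorem forwardTrapped_subset {F : ℝ × ℝ → ℝ × ℝ} {N : Set (ℝ × ℝ)} : forwardTrapped F N ⊆ N :=
  fun _ ⟨_, _, h2, h3⟩ => h2 ▸ h3 0 le_rfl

theorem localStableManifold_subset_forwardTrapped {F : ℝ × ℝ → ℝ × ℝ} {p : ℝ × ℝ}
    {N : Set (ℝ × ℝ)} : localStableManifold F p N ⊆ forwardTrapped F N :=
  fun _ ⟨γ, h1, h2, h3, _⟩ => ⟨γ, h1, h2, h3⟩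

theorem isForwardSolution_const {F : ℝ × ℝ → ℝ × ℝ} {p : ℝ × ℝ} (h : F p = 0) :
    IsForwardSolution F fun _ => p := fun t _ => by
  simpa only [h] using hasDerivWithinAt_const t (Ici 0) p

/-- Near `p`, every local stable manifold of `p` agrees with a stable curve through `p`. -/
theorem IsStableCurve.exists_inter_eq {F : ℝ × ℝ → ℝ × ℝ} {p : ℝ × ℝ} {k : ℝ → ℝ × ℝ} {ε : ℝ}
    {U : Set (ℝ × ℝ)} (hk : IsStableCurve F p k ε U) {π : ℝ × ℝ → ℝ} (hπ : Continuous π)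
    (hπk : ∀ s, π (k s) = s) {N : Set (ℝ × ℝ)} (hN : N ∈ 𝓝 p) (hNU : N ⊆ U) :
    ∃ V ∈ 𝓝 p, ∃ η ∈ Ioc 0 ε, localStableManifold F p N ∩ V = k '' Ioo (-η) η := by
  have h1 : k ⁻¹' N ∈ 𝓝 (0 : ℝ) := hk.continuousAt (by rwa [hk.apply_zero])
  obtain ⟨η₀, hη₀, hball⟩ := Metric.mem_nhds_iff.1 h1
  -- The whole arc with parameters in `(-η, η)` lies in `N`. A trajectory starting on it only runs
  -- towards `p` along the arc, hence stays in `N`.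
  set η := min η₀ ε
  have hη : 0 < η := lt_min hη₀ hk.pos
  have hπp : π p = 0 := by rw [← hk.apply_zero, hπk]
  refine ⟨π ⁻¹' Ioo (-η) η, hπ.continuousAt (by
    rw [hπp]; exact Ioo_mem_nhds (neg_lt_zero.2 hη) hη), η, ⟨hη, min_le_right _ _⟩, ?_⟩
  apply Subset.antisymm
  · rintro q ⟨hq, hqV⟩
    obtain ⟨s, -, rfl⟩ := hk.trapped (forwardTrapped_mono hNU
      (localStableManifold_subset_forwardTrapped hq))
    rw [mem_preimage, hπk] at hqV
    exact ⟨s, hqV, rfl⟩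
  · rintro _ ⟨s, hs, rfl⟩
    refine ⟨?_, by rwa [mem_preimage, hπk]⟩
    rcases eq_or_ne s 0 with rfl | hs0
    · rw [hk.apply_zero]
      exact ⟨fun _ => p, isForwardSolution_const hk.stationary, rfl,
        fun _ _ => mem_of_mem_nhds hN, tendsto_const_nhds⟩
    · obtain ⟨σ, hσ, hσs⟩ : ∃ σ : ℝ, (σ = 1 ∨ σ = -1) ∧ σ * |s| = s := by
        rcases hs0.lt_or_gt with h | h
        · exact ⟨-1, Or.inr rfl, by rw [abs_of_neg h]; ring⟩
        · exact ⟨1, Or.inl rfl, by rw [abs_of_pos h]; ring⟩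
      have hsη : |s| < η := abs_lt.2 hs
      obtain ⟨γ, h1, h2, h3, h4⟩ := hk.half σ hσ |s|
        ⟨abs_pos.2 hs0, hsη.trans_le (min_le_right _ _)⟩
      refine ⟨γ, h1, by rw [h2, hσs], fun t ht => ?_, h4⟩
      obtain ⟨r, hr, hrt⟩ : γ t ∈ (fun s => k (σ * s)) '' Ioc 0 |s| :=
        h3 ▸ mem_image_of_mem γ (mem_Ici.2 ht)
      rw [← hrt]
      refine hball ?_
      have hσ1 : |σ| = 1 := by rcases hσ with rfl | rfl <;> simp
      rw [Metric.mem_ball, Real.dist_0_eq_abs, abs_mul, hσ1, one_mul, abs_of_pos hr.1]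
      exact (hr.2.trans_lt hsη).trans_le (min_le_left _ _)

/-- The two halves of a stable curve contain all trajectories that stay in a neighbourhood on which
the parameter of the curve is bounded by `δ`. -/
theorem IsStableCurve.exists_separatrices {F : ℝ × ℝ → ℝ × ℝ} {p : ℝ × ℝ} {k : ℝ → ℝ × ℝ} {ε : ℝ}
    {U : Set (ℝ × ℝ)} (hk : IsStableCurve F p k ε U) {π : ℝ × ℝ → ℝ}
    (hπk : ∀ s, π (k s) = s) {δ : ℝ} (hδ : δ ∈ Ioo 0 ε) {N : Set (ℝ × ℝ)} (hNU : N ⊆ U)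
    (hNδ : ∀ q ∈ N, |π q| ≤ δ) :
    ∃ γ₁ γ₂ : ℝ → ℝ × ℝ, IsForwardSolution F γ₁ ∧ IsForwardSolution F γ₂ ∧
      Tendsto γ₁ atTop (𝓝 p) ∧ Tendsto γ₂ atTop (𝓝 p) ∧ γ₁ 0 ≠ p ∧ γ₂ 0 ≠ p ∧
      Disjoint (γ₁ '' Ici 0) (γ₂ '' Ici 0) ∧
      forwardTrapped F N ⊆ {p} ∪ γ₁ '' Ici 0 ∪ γ₂ '' Ici 0 := by
  obtain ⟨γ₁, h1, h2, h3, h4⟩ := hk.half 1 (Or.inl rfl) δ hδ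
  obtain ⟨γ₂, g1, g2, g3, g4⟩ := hk.half (-1) (Or.inr rfl) δ hδ
  have hπp : π p = 0 := by rw [← hk.apply_zero, hπk]
  refine ⟨γ₁, γ₂, h1, g1, h4, g4, ?_, ?_, ?_, ?_⟩
  · intro h
    have := congrArg π h
    rw [h2, hπk, hπp] at this
    linarith [hδ.1]
  · intro h
    have := congrArg π h
    rw [g2, hπk, hπp] at this
    linarith [hδ.1]
  · rw [h3, g3, disjoint_left]
    rintro _ ⟨s, hs, rfl⟩ ⟨r, hr, hrs⟩
    have := congrArg π hrs
    simp only [hπk] at this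
    linarith [hs.1, hr.1]
  · intro q hq
    obtain ⟨s, -, rfl⟩ := hk.trapped (forwardTrapped_mono hNU hq)
    have hs := hNδ _ (forwardTrapped_subset hq)
    rw [hπk, abs_le] at hs
    rw [h3, g3]
    rcases lt_trichotomy s 0 with h | rfl | h
    · exact Or.inr ⟨-s, ⟨by linarith, by linarith⟩, by simp⟩
    · exact Or.inl (Or.inl hk.apply_zero)
    · exact Or.inl (Or.inr ⟨s, ⟨h, hs.2⟩, by simp⟩)

/-! ### Time reversal -/

theorem isBackwardSolution_iff {F : ℝ × ℝ → ℝ × ℝ} {γ : ℝ → ℝ × ℝ} :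
    IsBackwardSolution F γ ↔ IsForwardSolution (fun z => -F z) fun t => γ (-t) := by
  constructor
  · intro h t ht
    have h1 := (h (-t) (by simpa using ht)).scomp t ((hasDerivAt_neg t).hasDerivWithinAt (s := Ici 0))
      (fun s hs => by simpa using hs)
    simpa using! h1
  · intro h t ht
    have h1 := (h (-t) (by simpa using ht)).scomp t ((hasDerivAt_neg t).hasDerivWithinAt (s := Iic 0))
      (fun s hs => by simpa using hs)
    simpa [Function.comp_def] using h1

theorem isBackwardSolution_comp_neg_iff {F : ℝ × ℝ → ℝ × ℝ} {γ : ℝ → ℝ × ℝ} :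
    IsBackwardSolution F (fun t => γ (-t)) ↔ IsForwardSolution (fun z => -F z) γ := by
  rw [isBackwardSolution_iff]; simp

theorem backwardTrapped_eq {F : ℝ × ℝ → ℝ × ℝ} {N : Set (ℝ × ℝ)} :
    backwardTrapped F N = forwardTrapped (fun z => -F z) N := by
  ext q
  constructor
  · rintro ⟨γ, h1, h2, h3⟩
    exact ⟨fun t => γ (-t), isBackwardSolution_iff.1 h1, by simpa using h2,
      fun t ht => h3 _ (by linarith)⟩
  · rintro ⟨γ, h1, h2, h3⟩
    exact ⟨fun t => γ (-t), isBackwardSolution_comp_neg_iff.2 h1, by simpa using h2,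
      fun t ht => h3 _ (by linarith)⟩

theorem localUnstableManifold_eq {F : ℝ × ℝ → ℝ × ℝ} {p : ℝ × ℝ} {N : Set (ℝ × ℝ)} :
    localUnstableManifold F p N = localStableManifold (fun z => -F z) p N := by
  ext q
  constructor
  · rintro ⟨γ, h1, h2, h3, h4⟩
    exact ⟨fun t => γ (-t), isBackwardSolution_iff.1 h1, by simpa using h2,
      fun t ht => h3 _ (by linarith), h4.comp tendsto_neg_atTop_atBot⟩
  · rintro ⟨γ, h1, h2, h3, h4⟩
    exact ⟨fun t => γ (-t), isBackwardSolution_comp_neg_iff.2 h1, by simpa using h2,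
      fun t ht => h3 _ (by linarith), h4.comp tendsto_neg_atBot_atTop⟩

/-- A stationary point with transversal stable and unstable curves is a saddle. -/
theorem isSaddlePoint_of_isStableCurve {F : ℝ × ℝ → ℝ × ℝ} {p : ℝ × ℝ} {k l : ℝ → ℝ × ℝ}
    {ε ε' : ℝ} {U U' : Set (ℝ × ℝ)} (hk : IsStableCurve F p k ε U)
    (hl : IsStableCurve (fun z => -F z) p l ε' U') {π π' : ℝ × ℝ → ℝ} (hπ : Continuous π)
    (hπ' : Continuous π') (hπk : ∀ s, π (k s) = s) (hπl : ∀ s, π' (l s) = s)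
    (hinter : ∀ s ∈ Ioo (-ε) ε, ∀ r ∈ Ioo (-ε') ε', k s = l r → s = 0) : IsSaddlePoint F p := by
  have hπp : π p = 0 := by rw [← hk.apply_zero, hπk]
  have hπp' : π' p = 0 := by rw [← hl.apply_zero, hπl]
  -- The separatrices start at parameters `±ε / 2` and `±ε' / 2`, so bounding the parameters on `N`
  -- puts every trapped point on one of them or at `p`.
  set N := U ∩ U' ∩ {q | |π q| ≤ ε / 2} ∩ {q | |π' q| ≤ ε' / 2} ∩ Metric.ball p 1 with hN
  have hN1 : N ⊆ U := fun q hq => hq.1.1.1.1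
  have hN2 : N ⊆ U' := fun q hq => hq.1.1.1.2
  have hε := hk.pos
  have hε' := hl.pos
  have hNp : N ∈ 𝓝 p := by
    refine inter_mem (inter_mem (inter_mem (inter_mem hk.mem_nhds hl.mem_nhds) ?_) ?_)
      (Metric.ball_mem_nhds p one_pos)
    · filter_upwards [hπ.abs.continuousAt.eventually (gt_mem_nhds
        (show |π p| < ε / 2 by rw [hπp, abs_zero]; linarith))] with q hq using le_of_lt hq
    · filter_upwards [hπ'.abs.continuousAt.eventually (gt_mem_nhds
        (show |π' p| < ε' / 2 by rw [hπp', abs_zero]; linarith))] with q hq using le_of_lt hq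
  refine ⟨hk.stationary, N, hNp, Metric.isBounded_ball.subset inter_subset_right, ?_, ?_, ?_⟩
  · exact hk.exists_separatrices hπk ⟨by linarith, by linarith⟩ hN1 fun q hq => hq.1.1.2
  · obtain ⟨γ₃, γ₄, h1, h2, h3, h4, h5, h6, h7, h8⟩ := hl.exists_separatrices hπl
      (δ := ε' / 2) ⟨by linarith, by linarith⟩ hN2 fun q hq => hq.1.2
    have him : ∀ γ : ℝ → ℝ × ℝ, (fun t => γ (-t)) '' Iic 0 = γ '' Ici 0 := fun γ => by
      rw [← image_image γ (fun t => -t)]; simp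
    refine ⟨fun t => γ₃ (-t), fun t => γ₄ (-t), isBackwardSolution_comp_neg_iff.2 h1,
      isBackwardSolution_comp_neg_iff.2 h2, h3.comp tendsto_neg_atBot_atTop,
      h4.comp tendsto_neg_atBot_atTop, by simpa using h5, by simpa using h6, ?_, ?_⟩
    · rwa [him, him]
    · rwa [him, him, backwardTrapped_eq]
  · apply Subset.antisymm
    · rintro q ⟨h1, h2⟩
      rw [backwardTrapped_eq] at h2
      obtain ⟨s, hs, rfl⟩ := hk.trapped (forwardTrapped_mono hN1 h1)
      obtain ⟨r, hr, hrs⟩ := hl.trapped (forwardTrapped_mono hN2 h2)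
      rw [hinter s hs r hr hrs.symm, hk.apply_zero]
      rfl
    · refine singleton_subset_iff.2 ⟨⟨fun _ => p, isForwardSolution_const hk.stationary, rfl,
        fun _ _ => mem_of_mem_nhds hNp⟩, ?_⟩
      rw [backwardTrapped_eq]
      exact ⟨fun _ => p, isForwardSolution_const hl.stationary, rfl,
        fun _ _ => mem_of_mem_nhds hNp⟩

/-! ### The saddle case -/

/-- The factor `c` is `1` for the field and `-1` for the reversed field. -/
theorem HasDerivWithinAt.coords {a b : ℝ} {γ : ℝ → ℝ × ℝ} {c t : ℝ} {s : Set ℝ}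
    (h : HasDerivWithinAt γ (c • cdkField a b (γ t)) s t) :
    HasDerivWithinAt (fun t => (γ t).1)
        (c * ((γ t).1 * radialRate a ((γ t).1 ^ 2) ((γ t).2 - 1))) s t ∧
      HasDerivWithinAt (fun t => (γ t).2 - 1)
        (c * heightRate b ((γ t).1 ^ 2) ((γ t).2 - 1)) s t := by
  have e : cdkField a b (γ t) = ((γ t).1 * radialRate a ((γ t).1 ^ 2) ((γ t).2 - 1),
      heightRate b ((γ t).1 ^ 2) ((γ t).2 - 1)) := by
    rw [← cdkField_eq]; simp
  rw [e] at h
  exact ⟨(ContinuousLinearMap.fst ℝ ℝ ℝ).hasFDerivAt.comp_hasDerivWithinAt t h,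
    ((ContinuousLinearMap.snd ℝ ℝ ℝ).hasFDerivAt.comp_hasDerivWithinAt t h).sub_const 1⟩

theorem IsForwardSolution.coords {a b : ℝ} {γ : ℝ → ℝ × ℝ}
    (h : IsForwardSolution (cdkField a b) γ) {t : ℝ} (ht : 0 ≤ t) :
    HasDerivWithinAt (fun t => (γ t).1)
        ((γ t).1 * radialRate a ((γ t).1 ^ 2) ((γ t).2 - 1)) (Ici 0) t ∧
      HasDerivWithinAt (fun t => (γ t).2 - 1)
        (heightRate b ((γ t).1 ^ 2) ((γ t).2 - 1)) (Ici 0) t := by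
  have h1 : HasDerivWithinAt γ ((1 : ℝ) • cdkField a b (γ t)) (Ici 0) t := by
    rw [one_smul]; exact h t ht
  simpa using h1.coords

theorem cdkField_stationary (a b : ℝ) : cdkField a b (0, 1) = 0 := by
  ext <;> simp [cdkField]

/-- The logarithmic derivative of `x * exp (-κ w)` with `κ = (2 a - 1) / b` along the flow. -/
theorem exists_pos_rate {a b : ℝ} (hb : 0 < b) (hab : a < 1 ∨ a = 1 ∧ b < 1) :
    ∃ c > 0, ∀ᶠ z in 𝓝 ((0, 1) : ℝ × ℝ), c * z.1 ^ 2 ≤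
      radialRate a (z.1 ^ 2) (z.2 - 1) - (2 * a - 1) / b * heightRate b (z.1 ^ 2) (z.2 - 1) := by
  rcases hab with ha | ⟨rfl, hb1⟩
  · refine ⟨1, one_pos, ?_⟩
    have hc : Continuous fun z : ℝ × ℝ => radialRate a (z.1 ^ 2) (z.2 - 1) -
        (2 * a - 1) / b * heightRate b (z.1 ^ 2) (z.2 - 1) - 1 * z.1 ^ 2 := by fun_prop
    have h0 := (hc.tendsto (0, 1)).eventually (lt_mem_nhds (a := 0) (by
      simp only [radialRate, heightRate]; norm_num; exact ha))
    filter_upwards [h0] with z hz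
    linarith
  · have hb' : 1 < 1 / b := (one_lt_div hb).2 hb1
    refine ⟨(1 / b - 1) / 2, by linarith, ?_⟩
    have hc : Continuous fun z : ℝ × ℝ => |z.2 - 1| := by fun_prop
    have h0 := (hc.tendsto (0, 1)).eventually (gt_mem_nhds (a := min 1 ((1 / b - 1) / 2)) (by
      rw [sub_self, abs_zero]
      exact lt_min one_pos (by linarith)))
    filter_upwards [h0] with z hz
    have h1 := abs_lt.1 (hz.trans_le (min_le_left _ _))
    have h2 := abs_lt.1 (hz.trans_le (min_le_right _ _))
    -- The multiple of `heightRate` is chosen to cancel the term linear in `w`. What remains for `a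
    -- = 1` is `(1 / b - 1) u` plus a nonnegative term and the small error `u w`.
    have e : radialRate 1 (z.1 ^ 2) (z.2 - 1) -
        (2 * 1 - 1) / b * heightRate b (z.1 ^ 2) (z.2 - 1) =
        (1 / b - 1) * z.1 ^ 2 + (z.2 - 1) ^ 2 * (1 + (z.2 - 1)) + z.1 ^ 2 * (z.2 - 1) := by
      simp only [radialRate, heightRate]
      field_simp
      ring
    rw [e]
    have h3 : 0 ≤ (z.2 - 1) ^ 2 * (1 + (z.2 - 1)) := mul_nonneg (sq_nonneg _) (by linarith)
    have h4 := mul_le_mul_of_nonneg_left h2.1.le (sq_nonneg z.1)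
    linarith

/-- The weight `P = x ^ 2 * exp (-2 B w)` has logarithmic derivative at least `2 c x ^ 2`. On `U`
this is at least `2 c exp (-2 |B|) P`, and `P ≥ P 0` by monotonicity. So if `P 0 > 0`, the bounded
function `P` would grow exponentially, even when `a = 1`. -/
theorem fst_eq_zero_of_forwardTrapped {a b c B : ℝ} (hc : 0 < c) {U : Set (ℝ × ℝ)}
    (hU : ∀ z ∈ U, |z.1| ≤ 1 ∧ |z.2 - 1| ≤ 1 ∧ c * z.1 ^ 2 ≤
      radialRate a (z.1 ^ 2) (z.2 - 1) - B * heightRate b (z.1 ^ 2) (z.2 - 1))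
    {q : ℝ × ℝ} (hq : q ∈ forwardTrapped (cdkField a b) U) : q.1 = 0 := by
  obtain ⟨γ, hγ, rfl, htrap⟩ := hq
  set P : ℝ → ℝ := fun t => (γ t).1 ^ 2 * Real.exp (-2 * B * ((γ t).2 - 1)) with hP
  have hPnn : ∀ t, 0 ≤ P t := fun t => by positivity
  have hder : ∀ t, 0 ≤ t → HasDerivWithinAt P
      (2 * P t * (radialRate a ((γ t).1 ^ 2) ((γ t).2 - 1) -
        B * heightRate b ((γ t).1 ^ 2) ((γ t).2 - 1))) (Ici 0) t := by
    intro t ht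
    obtain ⟨hx, hw⟩ := hγ.coords ht
    refine ((hx.fun_pow 2).fun_mul (hw.const_mul (-2 * B)).exp).congr_deriv ?_
    simp only [hP]
    push_cast
    ring
  have hexp : ∀ t, 0 ≤ t → Real.exp (-(2 * |B|)) * P t ≤ (γ t).1 ^ 2 ∧
      P t ≤ Real.exp (2 * |B|) := by
    intro t ht
    obtain ⟨h1, h2, -⟩ := hU _ (htrap t ht)
    have h3 : |2 * B * ((γ t).2 - 1)| ≤ 2 * |B| := by
      rw [abs_mul, abs_mul, abs_two]
      exact mul_le_of_le_one_right (by positivity) h2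
    rw [abs_le] at h3
    constructor
    · calc _ = (γ t).1 ^ 2 * Real.exp (-(2 * |B|) + -2 * B * ((γ t).2 - 1)) := by
            rw [Real.exp_add]; simp only [hP]; ring
        _ ≤ (γ t).1 ^ 2 * 1 := by
            gcongr
            rw [Real.exp_le_one_iff]
            linarith
        _ = _ := mul_one _
    · have h4 : (γ t).1 ^ 2 ≤ 1 := (sq_le_one_iff_abs_le_one _).2 h1
      have h5 : Real.exp (-2 * B * ((γ t).2 - 1)) ≤ Real.exp (2 * |B|) :=
        Real.exp_le_exp.2 (by linarith)
      exact (mul_le_mul h4 h5 (Real.exp_pos _).le zero_le_one).trans_eq (one_mul _)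
  have hmono : ∀ t, 0 ≤ t → P 0 ≤ P t := by
    have : AntitoneOn (fun t => -P t) (Ici 0) := by
      refine antitoneOn_Ici_of_hasDerivWithinAt (fun t ht => (hder t ht).fun_neg) (fun t ht => ?_)
      have h1 := (hU _ (htrap t ht)).2.2
      have h2 : 0 ≤ c * (γ t).1 ^ 2 := by positivity
      have h3 := mul_nonneg (hPnn t) (h2.trans h1)
      linarith
    intro t ht
    have := this (mem_Ici.2 le_rfl) (mem_Ici.2 ht) ht
    linarith
  by_contra hne
  have hP0 : 0 < P 0 := by positivity
  have := nonpos_of_growth hder (κ := 2 * c * Real.exp (-(2 * |B|)) * P 0) (by positivity)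
    (fun t ht => ?_) (fun t ht => (hexp t ht).2)
  · exact absurd this (not_le.2 hP0)
  · have h1 := (hU _ (htrap t ht)).2.2
    calc 2 * c * Real.exp (-(2 * |B|)) * P 0 * P t
        ≤ 2 * c * Real.exp (-(2 * |B|)) * P t * P t := by
          have := hPnn t
          gcongr
          exact hmono t ht
      _ = 2 * P t * (c * (Real.exp (-(2 * |B|)) * P t)) := by ring
      _ ≤ 2 * P t * (c * (γ t).1 ^ 2) := by
          have := hPnn t
          gcongr
          exact (hexp t ht).1
      _ ≤ _ := mul_le_mul_of_nonneg_left h1 (by linarith [hPnn t])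

/-- The `y`-axis is the stable curve of the saddle. -/
theorem exists_isStableCurve_axis {a b : ℝ} (hb : 0 < b) (hab : a < 1 ∨ a = 1 ∧ b < 1) :
    ∃ U, IsStableCurve (cdkField a b) (0, 1) (fun s => (0, 1 + s)) (1 / 2) U := by
  obtain ⟨c, hc, hev⟩ := exists_pos_rate hb hab
  have h1 : ∀ᶠ z in 𝓝 ((0, 1) : ℝ × ℝ), |z.1| < 1 :=
    (by fun_prop : Continuous fun z : ℝ × ℝ => |z.1|).continuousAt.eventually (gt_mem_nhds (by simp))
  have h2 : ∀ᶠ z in 𝓝 ((0, 1) : ℝ × ℝ), |z.2 - 1| < 1 / 2 :=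
    (by fun_prop : Continuous fun z : ℝ × ℝ => |z.2 - 1|).continuousAt.eventually
      (gt_mem_nhds (by simp))
  refine ⟨_, by norm_num, by simp, cdkField_stationary a b, h1.and (h2.and hev), by fun_prop,
    ?_, ?_⟩
  · intro σ hσ δ hδ
    have hXs : ContDiff ℝ 1 fun s : ℝ => -(b * s * (1 + σ * s) ^ 2) := by fun_prop
    obtain ⟨K, hK⟩ := hXs.contDiffOn.exists_lipschitzOnWith one_ne_zero (convex_Icc 0 δ)
      isCompact_Icc
    have hneg : ∀ s ∈ Ioc 0 δ, -(b * s * (1 + σ * s) ^ 2) < 0 := by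
      intro s hs
      -- Parameters below `1 / 2` avoid the other zero of the field on the axis, the origin, where
      -- `σ * s = -1`.
      have h3 : 0 < 1 + σ * s := by
        rcases hσ with rfl | rfl <;> linarith [hs.1, hs.2, hδ.2]
      have := mul_pos (mul_pos hb hs.1) (pow_pos h3 2)
      linarith
    have hder : ∀ s : ℝ, HasDerivAt (fun s => ((0, 1 + σ * s) : ℝ × ℝ)) (0, σ) s := by
      intro s
      have := ((hasDerivAt_id s).const_mul σ).const_add 1
      simp only [id, mul_one] at this
      exact (hasDerivAt_const s (0 : ℝ)).prodMk this
    have hF : ∀ s : ℝ, -(b * s * (1 + σ * s) ^ 2) • ((0, σ) : ℝ × ℝ) =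
        cdkField a b (0, 1 + σ * s) := by
      intro s
      rw [cdkField_eq]
      simp only [heightRate, Prod.smul_mk, smul_eq_mul]
      ext <;> simp
      ring
    obtain ⟨γ, g1, g2, g3, g4⟩ := exists_solution_on_curve hδ.1 hK (by simp) hneg
      (fun s _ => hder s) (fun s _ => hF s)
    exact ⟨γ, g1, g2, g3, by simpa using g4⟩
  · intro q hq
    have h3 := fst_eq_zero_of_forwardTrapped hc (B := (2 * a - 1) / b)
      (fun z hz => ⟨hz.1.le, hz.2.1.le.trans (by norm_num), hz.2.2⟩) hq
    have h4 := abs_lt.1 (forwardTrapped_subset hq).2.1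
    exact ⟨q.2 - 1, ⟨h4.1, h4.2⟩, by ext <;> simp [h3]⟩

theorem contDiffOn_one_of_hasDerivAt {h h' : ℝ → ℝ} {s : Set ℝ} (hs : IsOpen s)
    (hd : ∀ x ∈ s, HasDerivAt h (h' x) x) (hc : ContinuousOn h' s) : ContDiffOn ℝ 1 h s := by
  rw [show (1 : WithTop ℕ∞) = 0 + 1 from (zero_add 1).symm, contDiffOn_succ_iff_deriv_of_isOpen hs]
  refine ⟨fun x hx => (hd x hx).differentiableAt.differentiableWithinAt, by simp, ?_⟩
  rw [contDiffOn_zero]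
  exact hc.congr fun x hx => (hd x hx).deriv

/-- An invariant graph on which the field points away from the saddle is the stable curve of the
reversed field. -/
theorem exists_isStableCurve_graph {a b ε : ℝ} {h h' : ℝ → ℝ} (hb : 0 < b) (hε : 0 < ε)
    (h0 : h 0 = 0) (h'0 : h' 0 = 0) (hcont : ContinuousOn h' (Ioo (-ε) ε))
    (hgraph : ∀ x ∈ Ioo (-ε) ε, HasDerivAt h (h' x) x ∧
      heightRate b (x ^ 2) (h x) = h' x * (x * radialRate a (x ^ 2) (h x)) ∧
      (x ≠ 0 → 0 < radialRate a (x ^ 2) (h x))) :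
    ∃ U, IsStableCurve (fun z => -cdkField a b z) (0, 1) (fun s => (s, 1 + h s)) ε U := by
  have hmem0 : (0 : ℝ) ∈ Ioo (-ε) ε := ⟨by linarith, hε⟩
  have hh : ContinuousAt h 0 := (hgraph 0 hmem0).1.continuousAt
  have hh' : ContinuousAt h' 0 := hcont.continuousAt (Ioo_mem_nhds hmem0.1 hmem0.2)
  have hhf : ContinuousAt (fun z : ℝ × ℝ => h z.1) (0, 1) :=
    ContinuousAt.comp (f := Prod.fst) (x := ((0, 1) : ℝ × ℝ)) hh continuousAt_fst
  have hhf' : ContinuousAt (fun z : ℝ × ℝ => h' z.1) (0, 1) :=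
    ContinuousAt.comp (f := Prod.fst) (x := ((0, 1) : ℝ × ℝ)) hh' continuousAt_fst
  have h1 : ∀ᶠ z in 𝓝 ((0, 1) : ℝ × ℝ), |z.1| < ε :=
    (by fun_prop : Continuous fun z : ℝ × ℝ => |z.1|).continuousAt.eventually
      (gt_mem_nhds (by simpa using hε))
  have h2 : ∀ᶠ z in 𝓝 ((0, 1) : ℝ × ℝ), |z.2 - 1 - h z.1| < 1 := by
    have : ContinuousAt (fun z : ℝ × ℝ => |z.2 - 1 - h z.1|) (0, 1) := by fun_prop
    exact this.eventually (gt_mem_nhds (by simp [h0]))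
  -- This is the logarithmic derivative, for the unreversed flow, of the distance `w - h x` to the
  -- graph. Its value at the stationary point is `-b`.
  have h3 : ∀ᶠ z in 𝓝 ((0, 1) : ℝ × ℝ), heightSlope b (z.1 ^ 2) (z.2 - 1) (h z.1) -
      h' z.1 * z.1 * radialSlope a (z.2 - 1) (h z.1) < -(b / 2) := by
    have : ContinuousAt (fun z : ℝ × ℝ => heightSlope b (z.1 ^ 2) (z.2 - 1) (h z.1) -
        h' z.1 * z.1 * radialSlope a (z.2 - 1) (h z.1)) (0, 1) := by
      unfold heightSlope radialSlope; fun_prop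
    refine this.eventually (gt_mem_nhds ?_)
    simp only [heightSlope, radialSlope, h0, h'0]
    norm_num
    exact hb
  have hC1 := contDiffOn_one_of_hasDerivAt isOpen_Ioo (fun x hx => (hgraph x hx).1) hcont
  refine ⟨_, hε, by simp [h0], by simp [cdkField_stationary], h1.and (h2.and h3), by fun_prop,
    ?_, ?_⟩
  · intro σ hσ δ hδ
    have hσ2 : σ ^ 2 = 1 := by rcases hσ with rfl | rfl <;> norm_num
    have hmaps : ∀ s ∈ Icc 0 δ, σ * s ∈ Ioo (-ε) ε := by
      intro s hs
      rcases hσ with rfl | rfl <;> constructor <;> linarith [hs.1, hs.2, hδ.2]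
    have hXs : ContDiffOn ℝ 1 (fun s : ℝ => -(s * radialRate a (s ^ 2) (h (σ * s)))) (Icc 0 δ) := by
      have : ContDiffOn ℝ 1 (fun s => h (σ * s)) (Icc 0 δ) :=
        hC1.comp (f := fun s => σ * s) (by fun_prop) hmaps
      unfold radialRate
      exact (contDiffOn_id.mul ((((contDiffOn_const.add (contDiffOn_const.mul this)).sub
        (contDiffOn_const.mul (this.pow 2)))).sub (contDiffOn_const.mul (contDiffOn_id.pow 2)))).neg
    obtain ⟨K, hK⟩ := hXs.exists_lipschitzOnWith one_ne_zero (convex_Icc 0 δ) isCompact_Icc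
    have hneg : ∀ s ∈ Ioc 0 δ, -(s * radialRate a (s ^ 2) (h (σ * s))) < 0 := by
      intro s hs
      have hσs : σ * s ≠ 0 := by
        rcases hσ with rfl | rfl <;> simpa using hs.1.ne'
      have h4 := (hgraph _ (hmaps s (Ioc_subset_Icc_self hs))).2.2 hσs
      rw [mul_pow, hσ2, one_mul] at h4
      have := mul_pos hs.1 h4
      linarith
    have hder : ∀ s ∈ Icc 0 δ, HasDerivAt (fun s => (σ * s, 1 + h (σ * s)))
        (σ, h' (σ * s) * σ) s := by
      intro s hs
      have h4 : HasDerivAt (fun s => σ * s) σ s := by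
        simpa using (hasDerivAt_id s).const_mul σ
      exact h4.prodMk ((HasDerivAt.comp s (h := fun s => σ * s)
        (hgraph _ (hmaps s hs)).1 h4).const_add 1)
    have hF : ∀ s ∈ Icc 0 δ, -(s * radialRate a (s ^ 2) (h (σ * s))) •
        ((σ, h' (σ * s) * σ) : ℝ × ℝ) = -cdkField a b (σ * s, 1 + h (σ * s)) := by
      intro s hs
      have h4 := (hgraph _ (hmaps s hs)).2.1
      rw [cdkField_eq, h4, mul_pow, hσ2, one_mul]
      ext <;> simp <;> ring
    obtain ⟨γ, g1, g2, g3, g4⟩ := exists_solution_on_curve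
      (F := fun z => -cdkField a b z) hδ.1 hK (by simp) hneg hder hF
    exact ⟨γ, g1, g2, g3, by simpa [h0] using g4⟩
  · rintro q ⟨γ, hγ, rfl, htrap⟩
    set D : ℝ → ℝ := fun t => (γ t).2 - 1 - h (γ t).1 with hD
    have hder : ∀ t, 0 ≤ t → HasDerivWithinAt (fun t => D t ^ 2)
        (-2 * D t ^ 2 * (heightSlope b ((γ t).1 ^ 2) ((γ t).2 - 1) (h (γ t).1) -
          h' (γ t).1 * (γ t).1 * radialSlope a ((γ t).2 - 1) (h (γ t).1))) (Ici 0) t := by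
      intro t ht
      have h4 : HasDerivWithinAt γ ((-1 : ℝ) • cdkField a b (γ t)) (Ici 0) t := by
        rw [neg_one_smul]; exact hγ t ht
      obtain ⟨hx, hw⟩ := h4.coords
      obtain ⟨g1, g2, -⟩ := hgraph (γ t).1 (abs_lt.1 (htrap t ht).1)
      have h5 := (hw.fun_sub (g1.comp_hasDerivWithinAt t hx)).fun_pow 2
      refine h5.congr_deriv ?_
      have h6 := heightRate_sub b ((γ t).1 ^ 2) ((γ t).2 - 1) (h (γ t).1)
      have h7 := radialRate_sub a ((γ t).1 ^ 2) ((γ t).2 - 1) (h (γ t).1)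
      simp only [hD, Function.comp]
      push_cast
      -- Invariance of the graph (`g2`) removes the terms evaluated on it, so that only the divided
      -- differences times the distance `D` remain.
      linear_combination (-2 * ((γ t).2 - 1 - h (γ t).1)) *
        (h6 + g2 - h' (γ t).1 * (γ t).1 * h7)
    have h4 : D 0 ^ 2 ≤ 0 := by
      refine nonpos_of_growth hder hb (B := 1) (fun t ht => ?_) (fun t ht => ?_)
      · have := mul_le_mul_of_nonneg_left (htrap t ht).2.2.le (sq_nonneg (D t))
        linarith
      · exact (sq_le_one_iff_abs_le_one _).2 (htrap t ht).2.1.le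
    have h5 : D 0 = 0 := by nlinarith [sq_nonneg (D 0)]
    refine ⟨(γ 0).1, abs_lt.1 (htrap 0 le_rfl).1, ?_⟩
    ext
    · rfl
    · simp only [hD] at h5
      simp only
      linarith

theorem cdkField_saddle {a b : ℝ} (ha : 0 < a) (hb : 0 < b) (hab : a < 1 ∨ a = 1 ∧ b < 1) :
    IsSaddlePoint (cdkField a b) (0, 1) ∧
      UnstableManifoldTangentTo (cdkField a b) (0, 1) (1, 0) ∧
      StableManifoldTangentTo (cdkField a b) (0, 1) (0, 1) := by
  obtain ⟨U, hU⟩ := exists_isStableCurve_axis hb hab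
  obtain ⟨ε, hε, h, h', h0, h'0, hcont, hgraph⟩ := exists_invariant_graph ha hb hab
  obtain ⟨U', hU'⟩ := exists_isStableCurve_graph hb hε h0 h'0 hcont hgraph
  refine ⟨?_, ⟨U', hU'.mem_nhds, fun N hN hNU => ?_⟩, ⟨U, hU.mem_nhds, fun N hN hNU => ?_⟩⟩
  · refine isSaddlePoint_of_isStableCurve hU hU' (π := fun z => z.2 - 1) (π' := fun z => z.1)
      (by fun_prop) (by fun_prop) (by simp) (by simp) ?_
    intro s _ r _ hsr
    rw [Prod.mk.injEq] at hsr
    obtain ⟨rfl, h2⟩ := hsr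
    rw [h0] at h2
    linarith
  · obtain ⟨V, hV, η, hη, hSV⟩ := hU'.exists_inter_eq (π := fun z => z.1) (by fun_prop)
      (by simp) hN hNU
    have hsub : Ioo (-η) η ⊆ Ioo (-ε) ε := Ioo_subset_Ioo (by linarith [hη.2]) hη.2
    refine ⟨by simp, V, hV, η, hη.1, h, ?_, h0, ?_, ?_⟩
    · exact contDiffOn_one_of_hasDerivAt isOpen_Ioo (fun x hx => (hgraph x (hsub hx)).1)
        (hcont.mono hsub)
    · rw [(hgraph 0 ⟨by linarith, hε⟩).1.deriv, h'0]
    · rw [localUnstableManifold_eq, hSV]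
      congr 1
      ext s <;> simp
  · obtain ⟨V, hV, η, hη, hSV⟩ := hU.exists_inter_eq (π := fun z => z.2 - 1) (by fun_prop)
      (by simp) hN hNU
    refine ⟨by simp, V, hV, η, hη.1, fun _ => 0, contDiffOn_const, rfl, by simp, ?_⟩
    rw [hSV]
    congr 1
    ext s <;> simp

/-! ### The node case -/

/-- The squared Euclidean distance to `(0, 1)`. -/
def sqDist (z : ℝ × ℝ) : ℝ := z.1 ^ 2 + (z.2 - 1) ^ 2

theorem sqDist_nonneg (z : ℝ × ℝ) : 0 ≤ sqDist z := by unfold sqDist; positivity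

theorem continuous_sqDist : Continuous sqDist := by unfold sqDist; fun_prop

theorem exists_sqDist_le_subset {N : Set (ℝ × ℝ)} (hN : N ∈ 𝓝 ((0, 1) : ℝ × ℝ)) :
    ∃ ρ > 0, ρ ≤ 1 ∧ ∀ z, sqDist z ≤ ρ → z ∈ N := by
  obtain ⟨r, hr, hball⟩ := Metric.mem_nhds_iff.1 hN
  refine ⟨min 1 ((r / 2) ^ 2), lt_min one_pos (by positivity), min_le_left _ _,
    fun z hz => hball ?_⟩
  have h1 : z.1 ^ 2 + (z.2 - 1) ^ 2 ≤ (r / 2) ^ 2 := hz.trans (min_le_right _ _)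
  have h2 : |z.1| ≤ r / 2 := abs_le_of_sq_le_sq (by nlinarith [sq_nonneg (z.2 - 1)]) (by linarith)
  have h3 : |z.2 - 1| ≤ r / 2 := abs_le_of_sq_le_sq (by nlinarith [sq_nonneg z.1]) (by linarith)
  rw [Metric.mem_ball, Prod.dist_eq, Real.dist_eq, Real.dist_eq]
  simp only [sub_zero]
  exact max_lt (by linarith) (by linarith)

theorem sqDist_le_mem_nhds {ρ : ℝ} (hρ : 0 < ρ) : {z | sqDist z ≤ ρ} ∈ 𝓝 ((0, 1) : ℝ × ℝ) := by
  filter_upwards [continuous_sqDist.continuousAt.eventually (gt_mem_nhds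
    (show sqDist (0, 1) < ρ by simpa [sqDist] using hρ))] with z hz using le_of_lt hz

theorem hasDerivWithinAt_sqDist {γ : ℝ → ℝ × ℝ} {v : ℝ × ℝ} {t : ℝ} {s : Set ℝ}
    (h : HasDerivWithinAt γ v s t) :
    HasDerivWithinAt (fun t => sqDist (γ t)) (2 * ((γ t).1 * v.1 + ((γ t).2 - 1) * v.2)) s t := by
  have h1 : HasDerivWithinAt (fun t => (γ t).1) v.1 s t :=
    (ContinuousLinearMap.fst ℝ ℝ ℝ).hasFDerivAt.comp_hasDerivWithinAt t h
  have h2 : HasDerivWithinAt (fun t => (γ t).2 - 1) v.2 s t :=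
    ((ContinuousLinearMap.snd ℝ ℝ ℝ).hasFDerivAt.comp_hasDerivWithinAt t h).sub_const 1
  refine ((h1.fun_pow 2).fun_add (h2.fun_pow 2)).congr_deriv ?_
  push_cast
  ring

/-- `sqDist` is a strict Lyapunov function of the node. -/
theorem exists_lyapunov {a b : ℝ} (hb : 0 < b) (hab : 1 < a ∨ a = 1 ∧ 1 < b) :
    ∃ κ > 0, ∃ ρ > 0, ρ ≤ 1 ∧ ∀ z, sqDist z ≤ ρ →
      z.1 * (cdkField a b z).1 + (z.2 - 1) * (cdkField a b z).2 ≤ -κ * sqDist z ^ 2 := by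
  have heq : ∀ z : ℝ × ℝ, z.1 * (cdkField a b z).1 + (z.2 - 1) * (cdkField a b z).2 =
      -(a - 1) * z.1 ^ 2 - 2 * a * z.1 ^ 2 * (z.2 - 1) - (a + b) * z.1 ^ 2 * (z.2 - 1) ^ 2
        - a * z.1 ^ 4 - b * (z.2 - 1) ^ 2 * (1 + (z.2 - 1)) ^ 2 := by
    intro z
    simp only [cdkField]
    ring
  have hw : ∀ e > 0, {z : ℝ × ℝ | |z.2 - 1| < e} ∈ 𝓝 ((0, 1) : ℝ × ℝ) := fun e he =>
    (by fun_prop : Continuous fun z : ℝ × ℝ => |z.2 - 1|).continuousAt.eventually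
      (gt_mem_nhds (by simpa using he))
  rcases hab with ha | ⟨rfl, hb1⟩
  · obtain ⟨ρ, hρ, hρ1, hN⟩ := exists_sqDist_le_subset
      (hw (min (1 / 2) ((a - 1) / (4 * a))) (lt_min (by norm_num)
        (div_pos (by linarith) (by linarith))))
    refine ⟨min ((a - 1) / 2) (b / 4), lt_min (by linarith) (by linarith), ρ, hρ, hρ1,
      fun z hz => ?_⟩
    have h1 : |z.2 - 1| < min (1 / 2) ((a - 1) / (4 * a)) := hN z hz
    have h2 := abs_lt.1 (h1.trans_le (min_le_left _ _))
    have h3 := abs_lt.1 (h1.trans_le (min_le_right _ _))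
    have h4 : -(2 * a * (z.2 - 1)) ≤ (a - 1) / 2 := by
      have h5 := mul_le_mul_of_nonneg_left h3.1.le (by linarith : 0 ≤ 2 * a)
      have h6 : 2 * a * -((a - 1) / (4 * a)) = -((a - 1) / 2) := by
        have : a ≠ 0 := by linarith
        field_simp
        ring
      linarith
    rw [heq]
    have h5 := mul_le_mul_of_nonneg_left h4 (sq_nonneg z.1)
    have h6 : 1 / 4 ≤ (1 + (z.2 - 1)) ^ 2 := by nlinarith
    have h7 := mul_le_mul_of_nonneg_left h6 (mul_nonneg hb.le (sq_nonneg (z.2 - 1)))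
    have h8 : 0 ≤ (a + b) * z.1 ^ 2 * (z.2 - 1) ^ 2 := by positivity
    have h9 : 0 ≤ a * z.1 ^ 4 := by positivity
    -- For `a > 1` the decay is even linear in `sqDist`. Since `sqDist z ≤ 1`, it implies the
    -- quadratic rate, which is what `a = 1` allows.
    have h10 : sqDist z ^ 2 ≤ sqDist z := by nlinarith [sqDist_nonneg z]
    have h11 : 0 ≤ min ((a - 1) / 2) (b / 4) := le_min (by linarith) (by linarith)
    have h12 := mul_le_mul_of_nonneg_left h10 h11
    have h13 : min ((a - 1) / 2) (b / 4) * sqDist z ≤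
        (a - 1) / 2 * z.1 ^ 2 + b / 4 * (z.2 - 1) ^ 2 := by
      rw [sqDist, mul_add]
      gcongr
      · exact min_le_left _ _
      · exact min_le_right _ _
    linarith
  · obtain ⟨ρ, hρ, hρ1, hN⟩ := exists_sqDist_le_subset
      (hw ((b - 1) / (4 * b)) (div_pos (by linarith) (by linarith)))
    -- Half of the excess `b - 1` absorbs the cubic term `2 b w ^ 3`. The remaining coefficient of
    -- `w ^ 2` is `β`, still above `1`.
    set β := (b + 1) / 2 with hβ
    have hβ1 : 1 < β := by rw [hβ]; linarith
    have hκ : 0 < (β - 1) / (β + 1) := div_pos (by linarith) (by linarith)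
    refine ⟨(β - 1) / (β + 1) / 2, by linarith, ρ, hρ, hρ1, fun z hz => ?_⟩
    have h3 := abs_lt.1 (show |z.2 - 1| < (b - 1) / (4 * b) from hN z hz)
    have hzz : z.1 ^ 2 + (z.2 - 1) ^ 2 ≤ 1 := hz.trans hρ1
    rw [heq]
    simp only [sqDist]
    generalize z.1 = x at *
    generalize z.2 - 1 = w at *
    have h4 : -(2 * b * w) ≤ (b - 1) / 2 := by
      have h5 := mul_le_mul_of_nonneg_left h3.1.le (by linarith : 0 ≤ 2 * b)
      have h6 : 2 * b * -((b - 1) / (4 * b)) = -((b - 1) / 2) := by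
        field_simp
        ring
      linarith
    have h5 := mul_le_mul_of_nonneg_left h4 (sq_nonneg w)
    -- The form `X ^ 2 + 2 X w + β w ^ 2` in `X = x ^ 2` has determinant `β - 1` and trace `β + 1`.
    -- Their quotient bounds its smaller eigenvalue from below.
    have h6 : (β - 1) / (β + 1) * ((x ^ 2) ^ 2 + w ^ 2) ≤
        (x ^ 2) ^ 2 + 2 * x ^ 2 * w + β * w ^ 2 := by
      rw [div_mul_eq_mul_div, div_le_iff₀ (by linarith)]
      nlinarith [sq_nonneg (x ^ 2 + (β + 1) / 2 * w), sq_nonneg ((β - 1) * w)]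
    have h7 : (x ^ 2 + w ^ 2) ^ 2 ≤ 2 * ((x ^ 2) ^ 2 + w ^ 2) := by
      have : (w ^ 2) ^ 2 ≤ w ^ 2 := by nlinarith [sq_nonneg x, sq_nonneg w]
      nlinarith [sq_nonneg (x ^ 2 - w ^ 2)]
    have h8 := mul_le_mul_of_nonneg_left h7 hκ.le
    have h9 : 0 ≤ (1 + b) * x ^ 2 * w ^ 2 := by positivity
    have h10 : 0 ≤ b * w ^ 4 := by positivity
    have h11 : β * w ^ 2 = b * w ^ 2 - w ^ 2 * ((b - 1) / 2) := by rw [hβ]; ring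
    linarith

/-- Discs around the node are positively invariant, also after modifying the field outside. -/
theorem sqDist_le_of_lyapunov {a b κ ρ : ℝ} (hκ : 0 < κ) (hρ : 0 < ρ)
    (hV : ∀ z, sqDist z ≤ ρ →
      z.1 * (cdkField a b z).1 + (z.2 - 1) * (cdkField a b z).2 ≤ -κ * sqDist z ^ 2)
    {c : ℝ × ℝ → ℝ × ℝ} (hc : ∀ z, sqDist z ≤ ρ → c z = z) {γ : ℝ → ℝ × ℝ}
    (hγ : ∀ t, 0 ≤ t → HasDerivWithinAt γ (cdkField a b (c (γ t))) (Ici 0) t)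
    (h0 : sqDist (γ 0) ≤ ρ) (t : ℝ) (ht : 0 ≤ t) : sqDist (γ t) ≤ ρ := by
  refine le_of_deriv_neg_of_eq (fun t ht => hasDerivWithinAt_sqDist (hγ t ht)) h0
    (fun t _ h => ?_) t ht
  rw [hc _ h.le]
  have h1 := hV _ h.le
  rw [h] at h1
  nlinarith [mul_pos hκ (pow_pos hρ 2)]

/-- The field is clipped to a rectangle around the unit disc, which makes it globally solvable. The
disc `sqDist ≤ ρ` is invariant for the clipped field, where it agrees with the original one. -/
theorem exists_forwardSolution_of_lyapunov {a b κ ρ : ℝ} (hκ : 0 < κ) (hρ : 0 < ρ) (hρ1 : ρ ≤ 1)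
    (hV : ∀ z, sqDist z ≤ ρ →
      z.1 * (cdkField a b z).1 + (z.2 - 1) * (cdkField a b z).2 ≤ -κ * sqDist z ^ 2)
    {q : ℝ × ℝ} (hq : sqDist q ≤ ρ) : ∃ γ, IsForwardSolution (cdkField a b) γ ∧ γ 0 = q := by
  set c : ℝ × ℝ → ℝ × ℝ := fun z => (max (-2) (min 2 z.1), max (-1) (min 3 z.2)) with hc
  have hclip : LipschitzWith 1 c := by
    simpa using ((LipschitzWith.prod_fst.const_min 2).const_max (-2)).prodMk
      ((LipschitzWith.prod_snd.const_min 3).const_max (-1))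
  have hcmem : ∀ z, c z ∈ Icc (-2 : ℝ) 2 ×ˢ Icc (-1 : ℝ) 3 := fun z =>
    ⟨⟨le_max_left _ _, max_le (by norm_num) (min_le_left _ _)⟩,
      ⟨le_max_left _ _, max_le (by norm_num) (min_le_left _ _)⟩⟩
  have hcid : ∀ z, sqDist z ≤ ρ → c z = z := by
    intro z hz
    have h1 : z.1 ^ 2 + (z.2 - 1) ^ 2 ≤ 1 := hz.trans hρ1
    have h2 := abs_le.1 ((sq_le_one_iff_abs_le_one z.1).1 (by nlinarith [sq_nonneg (z.2 - 1)]))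
    have h3 := abs_le.1 ((sq_le_one_iff_abs_le_one (z.2 - 1)).1 (by nlinarith [sq_nonneg z.1]))
    ext
    · simp only [hc]
      rw [min_eq_right (by linarith), max_eq_right (by linarith)]
    · simp only [hc]
      rw [min_eq_right (by linarith), max_eq_right (by linarith)]
  have hF : ContDiff ℝ 1 (cdkField a b) := by unfold cdkField; fun_prop
  have hcomp : IsCompact (Icc (-2 : ℝ) 2 ×ˢ Icc (-1 : ℝ) 3) := isCompact_Icc.prod isCompact_Icc
  obtain ⟨K, hK⟩ := hF.contDiffOn.exists_lipschitzOnWith one_ne_zero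
    ((convex_Icc (-2 : ℝ) 2).prod (convex_Icc (-1 : ℝ) 3)) hcomp
  obtain ⟨γ, hγ0, hγ⟩ := exists_isIntegralCurve_comp hcomp hK hclip hcmem q
  have hγ' : ∀ t, 0 ≤ t → HasDerivWithinAt γ (cdkField a b (c (γ t))) (Ici 0) t := fun t _ =>
    (hγ t).hasDerivWithinAt
  refine ⟨γ, fun t ht => ?_, hγ0⟩
  have h1 := hγ' t ht
  rwa [hcid _ (sqDist_le_of_lyapunov hκ hρ hV hcid hγ' (hγ0 ▸ hq) t ht)] at h1

theorem tendsto_sqDist_of_lyapunov {a b κ ρ : ℝ} (hκ : 0 < κ) (hρ : 0 < ρ)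
    (hV : ∀ z, sqDist z ≤ ρ →
      z.1 * (cdkField a b z).1 + (z.2 - 1) * (cdkField a b z).2 ≤ -κ * sqDist z ^ 2)
    {γ : ℝ → ℝ × ℝ} (hγ : IsForwardSolution (cdkField a b) γ) (h0 : sqDist (γ 0) ≤ ρ) :
    Tendsto (fun t => sqDist (γ t)) atTop (𝓝 0) := by
  have hle := sqDist_le_of_lyapunov hκ hρ hV (c := id) (fun _ _ => rfl) hγ h0
  refine tendsto_zero_of_deriv_le (fun t ht => hasDerivWithinAt_sqDist (hγ t ht))
    (fun t _ => sqDist_nonneg _) (fun t ht => ?_) (fun η hη => ⟨2 * κ * η ^ 2, by positivity,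
      fun t ht h => ?_⟩)
  · have h1 := hV _ (hle t ht)
    have h2 := mul_nonneg hκ.le (sq_nonneg (sqDist (γ t)))
    linarith
  · have h1 := hV _ (hle t ht)
    have h2 : κ * η ^ 2 ≤ κ * sqDist (γ t) ^ 2 := by gcongr
    linarith

theorem tendsto_of_tendsto_sqDist {γ : ℝ → ℝ × ℝ}
    (h : Tendsto (fun t => sqDist (γ t)) atTop (𝓝 0)) : Tendsto γ atTop (𝓝 (0, 1)) := by
  rw [tendsto_def]
  intro N hN
  obtain ⟨ρ, hρ, -, hsub⟩ := exists_sqDist_le_subset hN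
  filter_upwards [h.eventually (gt_mem_nhds hρ)] with t ht
  exact hsub _ (le_of_lt ht)

/-! ### Tangent directions at the node -/

theorem norm_inv_smul_smul {E : Type*} [NormedAddCommGroup E] [NormedSpace ℝ E] {c : ℝ}
    (hc : 0 < c) (v : E) : ‖c • v‖⁻¹ • (c • v) = ‖v‖⁻¹ • v := by
  rw [norm_smul, Real.norm_of_nonneg hc.le, smul_smul, mul_inv, mul_right_comm,
    inv_mul_cancel₀ hc.ne', one_mul]

theorem tendsto_norm_inv_smul {E : Type*} [NormedAddCommGroup E] [NormedSpace ℝ E] {f : ℝ → E}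
    {d : E} (hd : d ≠ 0) (hf : Tendsto f atTop (𝓝 d)) :
    Tendsto (fun t => ‖f t‖⁻¹ • f t) atTop (𝓝 (‖d‖⁻¹ • d)) :=
  (hf.norm.inv₀ (norm_ne_zero_iff.2 hd)).smul hf

/-- A planar curve in the right half-plane has a limiting direction if its slope converges in the
extended reals. -/
theorem exists_direction_of_slope {x w : ℝ → ℝ} (hx : ∀ᶠ t in atTop, 0 < x t) {c : EReal}
    (hc : Tendsto (fun t => ((w t / x t : ℝ) : EReal)) atTop (𝓝 c)) :
    ∃ d : ℝ × ℝ, Tendsto (fun t => ‖(x t, w t)‖⁻¹ • (x t, w t)) atTop (𝓝 d) := by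
  induction c with
  | coe c =>
    have hr : Tendsto (fun t => w t / x t) atTop (𝓝 c) := EReal.tendsto_coe.1 hc
    have hlim : Tendsto (fun t => ((1, w t / x t) : ℝ × ℝ)) atTop (𝓝 (1, c)) :=
      tendsto_const_nhds.prodMk_nhds hr
    refine ⟨_, (tendsto_norm_inv_smul (by simp) hlim).congr' ?_⟩
    filter_upwards [hx] with t ht
    have e : (x t, w t) = x t • ((1, w t / x t) : ℝ × ℝ) := by
      rw [Prod.smul_mk, smul_eq_mul, smul_eq_mul, mul_one, mul_div_cancel₀ _ ht.ne']
    rw [e, norm_inv_smul_smul ht]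
  | top =>
    have hr : Tendsto (fun t => w t / x t) atTop atTop := by
      refine tendsto_atTop.2 fun M => ?_
      filter_upwards [EReal.tendsto_nhds_top_iff_real.1 hc M] with t ht
      exact (EReal.coe_lt_coe_iff.1 ht).le
    have hlim : Tendsto (fun t => (((w t / x t)⁻¹, 1) : ℝ × ℝ)) atTop (𝓝 (0, 1)) :=
      hr.inv_tendsto_atTop.prodMk_nhds tendsto_const_nhds
    refine ⟨_, (tendsto_norm_inv_smul (by simp) hlim).congr' ?_⟩
    filter_upwards [hx, hr.eventually_gt_atTop 0] with t ht hrt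
    have hw : 0 < w t := by simpa [ht] using! (lt_div_iff₀ ht).1 hrt
    have e : (x t, w t) = w t • (((w t / x t)⁻¹, 1) : ℝ × ℝ) := by
      rw [Prod.smul_mk, smul_eq_mul, smul_eq_mul, mul_one, inv_div, mul_div_cancel₀ _ hw.ne']
    rw [e, norm_inv_smul_smul hw]
  | bot =>
    have hr : Tendsto (fun t => w t / x t) atTop atBot := by
      refine tendsto_atBot.2 fun M => ?_
      filter_upwards [EReal.tendsto_nhds_bot_iff_real.1 hc M] with t ht
      exact (EReal.coe_lt_coe_iff.1 ht).le
    have hlim : Tendsto (fun t => ((-(w t / x t)⁻¹, -1) : ℝ × ℝ)) atTop (𝓝 (-0, -1)) :=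
      hr.inv_tendsto_atBot.neg.prodMk_nhds tendsto_const_nhds
    refine ⟨_, (tendsto_norm_inv_smul (by simp) hlim).congr' ?_⟩
    filter_upwards [hx, hr.eventually_lt_atBot 0] with t ht hrt
    have hw : w t < 0 := by simpa [ht] using! (div_lt_iff₀ ht).1 hrt
    have e : (x t, w t) = -w t • ((-(w t / x t)⁻¹, -1) : ℝ × ℝ) := by
      rw [Prod.smul_mk, smul_eq_mul, smul_eq_mul, inv_div, neg_mul_neg, neg_mul_neg, mul_one,
        mul_div_cancel₀ _ hw.ne]
    rw [e, norm_inv_smul_smul (neg_pos.2 hw)]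

/-- A curve with tangent `(1, k)` at the node, `k ≠ 0`, that is crossed in one direction only. -/
theorem exists_transversal {a b k : ℝ} (hb : 0 < b) (hk : k ≠ 0) :
    ∃ A σ : ℝ, σ ≠ 0 ∧ ∀ᶠ x in 𝓝[>] (0 : ℝ), ∀ w, σ * (w - k * x + A * x ^ 2) = 0 →
      0 < σ * (heightRate b (x ^ 2) w - (k - 2 * A * x) * (x * radialRate a (x ^ 2) w)) := by
  by_cases hab : a - 1 = b
  -- Both eigenvalues equal `-b`, so lines are not crossed to first order. The curvature `A` makes
  -- the second-order coefficient `-1 - b A - 2 b k ^ 2 - (1 - 2 a) k ^ 2` negative.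
  · set A := |1 - 2 * a| * k ^ 2 / b with hA
    have hAb : b * A = |1 - 2 * a| * k ^ 2 := by rw [hA]; field_simp
    refine ⟨A, -1, by norm_num, ?_⟩
    have hc : Continuous fun x : ℝ => -1 - b * x * (k - A * x) - b * A
        - b * (k - A * x) ^ 2 * (2 + x * (k - A * x)) - (k - 2 * A * x) *
          ((1 - 2 * a) * (k - A * x) - a * x * (k - A * x) ^ 2 - a * x) := by fun_prop
    have h0 := (hc.tendsto 0).eventually (p := fun r => r < 0) (gt_mem_nhds (by
      have h1 := neg_abs_le (1 - 2 * a)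
      have h2 := mul_le_mul_of_nonneg_right h1 (sq_nonneg k)
      have h3 : 0 < b * k ^ 2 := by positivity
      nlinarith))
    filter_upwards [nhdsWithin_le_nhds h0, self_mem_nhdsWithin] with x hx hx0 w hw
    have hx0 : 0 < x := hx0
    obtain rfl : w = x * (k - A * x) := by linarith
    have e : heightRate b (x ^ 2) (x * (k - A * x)) -
        (k - 2 * A * x) * (x * radialRate a (x ^ 2) (x * (k - A * x))) =
        x ^ 2 * (-1 - b * x * (k - A * x) - b * A
        - b * (k - A * x) ^ 2 * (2 + x * (k - A * x)) - (k - 2 * A * x) *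
          ((1 - 2 * a) * (k - A * x) - a * x * (k - A * x) ^ 2 - a * x)) := by
      simp only [heightRate, radialRate]
      linear_combination x * (k - 2 * A * x) * hab
    rw [e]
    nlinarith [mul_neg_of_pos_of_neg (pow_pos hx0 2) hx]
  -- With distinct eigenvalues the line `w = k x` works: there `w' - k x' ≈ k (a - 1 - b) x`. Taking
  -- this coefficient as `σ` makes the product positive.
  · have hL : k * (a - 1 - b) ≠ 0 := mul_ne_zero hk (sub_ne_zero.2 hab)
    refine ⟨0, k * (a - 1 - b), hL, ?_⟩
    have hc : Continuous fun x : ℝ => k * (a - 1 - b) * (-x - b * x ^ 2 * k - b * k * (1 + x * k) ^ 2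
        - k * radialRate a (x ^ 2) (x * k)) := by fun_prop
    have h0 := (hc.tendsto 0).eventually (p := fun r => 0 < r) (lt_mem_nhds (by
      have h1 : 0 < (k * (a - 1 - b)) ^ 2 := by positivity
      simp only [radialRate]
      nlinarith))
    filter_upwards [nhdsWithin_le_nhds h0, self_mem_nhdsWithin] with x hx hx0 w hw
    have hx0 : 0 < x := hx0
    have hw' : w - k * x + 0 * x ^ 2 = 0 := (mul_eq_zero.1 hw).resolve_left hL
    obtain rfl : w = x * k := by linarith
    have h2 := mul_pos hx0 hx
    refine h2.trans_eq ?_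
    simp only [heightRate]
    ring

/-- For each `k ≠ 0`, `w / x` ends up on one side of `k - A x`, and this bound tends to `k`. So no
interval is crossed infinitely often, which in the compact space `EReal` means convergence. -/
theorem exists_slope_limit {a b : ℝ} (hb : 0 < b) {γ : ℝ → ℝ × ℝ}
    (hγ : IsForwardSolution (cdkField a b) γ) (hpos : ∀ t, 0 ≤ t → 0 < (γ t).1)
    (hlim : Tendsto (fun t => (γ t).1) atTop (𝓝 0)) :
    ∃ c : EReal, Tendsto (fun t => ((((γ t).2 - 1) / (γ t).1 : ℝ) : EReal)) atTop (𝓝 c) := by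
  have hev : ∀ᶠ t in atTop, 0 < (γ t).1 := by
    filter_upwards [eventually_ge_atTop 0] with t ht using hpos t ht
  have hlim' : Tendsto (fun t => (γ t).1) atTop (𝓝[>] 0) := tendsto_nhdsWithin_iff.2 ⟨hlim, hev⟩
  have key : ∀ k : ℝ, k ≠ 0 → ∃ A : ℝ,
      (∀ᶠ t in atTop, k - A * (γ t).1 ≤ ((γ t).2 - 1) / (γ t).1) ∨
      ∀ᶠ t in atTop, ((γ t).2 - 1) / (γ t).1 ≤ k - A * (γ t).1 := by
    intro k hk
    obtain ⟨A, σ, hσ, hcross⟩ := exists_transversal (a := a) hb hk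
    refine ⟨A, ?_⟩
    have hder : ∀ t, 0 ≤ t → HasDerivWithinAt
        (fun t => σ * ((γ t).2 - 1 - k * (γ t).1 + A * (γ t).1 ^ 2))
        (σ * (heightRate b ((γ t).1 ^ 2) ((γ t).2 - 1) - (k - 2 * A * (γ t).1) *
          ((γ t).1 * radialRate a ((γ t).1 ^ 2) ((γ t).2 - 1)))) (Ici 0) t := by
      intro t ht
      obtain ⟨hx, hw⟩ := hγ.coords ht
      refine (((hw.fun_sub (hx.const_mul k)).fun_add ((hx.fun_pow 2).const_mul A)).const_mul
        σ).congr_deriv ?_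
      push_cast
      ring
    have hsign := eventually_nonneg_or_nonpos hder
      ((hlim'.eventually hcross).mono fun t ht h => ht _ h)
    have hup : (∀ᶠ t in atTop, 0 ≤ (γ t).2 - 1 - k * (γ t).1 + A * (γ t).1 ^ 2) →
        ∀ᶠ t in atTop, k - A * (γ t).1 ≤ ((γ t).2 - 1) / (γ t).1 := fun h => by
      filter_upwards [h, hev] with t h1 h2
      rw [le_div_iff₀ h2]
      linarith
    have hdown : (∀ᶠ t in atTop, (γ t).2 - 1 - k * (γ t).1 + A * (γ t).1 ^ 2 ≤ 0) →
        ∀ᶠ t in atTop, ((γ t).2 - 1) / (γ t).1 ≤ k - A * (γ t).1 := fun h => by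
      filter_upwards [h, hev] with t h1 h2
      rw [div_le_iff₀ h2]
      linarith
    rcases hσ.lt_or_gt with h | h
    · rcases hsign with h1 | h1
      · exact Or.inr (hdown (h1.mono fun t ht => by nlinarith))
      · exact Or.inl (hup (h1.mono fun t ht => by nlinarith))
    · rcases hsign with h1 | h1
      · exact Or.inl (hup (h1.mono fun t ht => by nlinarith))
      · exact Or.inr (hdown (h1.mono fun t ht => by nlinarith))
  refine tendsto_of_no_upcrossings dense_univ ?_
  rintro e₁ - e₂ - h12 ⟨hf₁, hf₂⟩
  -- The excluded slope `0` is harmless: another real number lies between `0` and `e₂`.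
  obtain ⟨k, hk, hk₁, hk₂⟩ : ∃ k : ℝ, k ≠ 0 ∧ e₁ < k ∧ (k : EReal) < e₂ := by
    obtain ⟨k, hk₁, hk₂⟩ := EReal.lt_iff_exists_real_btwn.1 h12
    rcases eq_or_ne k 0 with rfl | hk
    · obtain ⟨l, hl₁, hl₂⟩ := EReal.lt_iff_exists_real_btwn.1 hk₂
      exact ⟨l, (EReal.coe_lt_coe_iff.1 hl₁).ne', hk₁.trans hl₁, hl₂⟩
    · exact ⟨k, hk, hk₁, hk₂⟩
  obtain ⟨A, hA⟩ := key k hk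
  have hlimA : Tendsto (fun t => k - A * (γ t).1) atTop (𝓝 k) := by
    simpa using tendsto_const_nhds.sub (hlim.const_mul A)
  rcases hA with hA | hA
  · obtain ⟨k₁, h1, h2⟩ := EReal.lt_iff_exists_real_btwn.1 hk₁
    refine hf₁ ?_
    filter_upwards [hA, hlimA.eventually (lt_mem_nhds (EReal.coe_lt_coe_iff.1 h2))] with t h3 h4
    exact not_lt.2 (h1.le.trans (EReal.coe_le_coe_iff.2 (h4.le.trans h3)))
  · obtain ⟨k₂, h1, h2⟩ := EReal.lt_iff_exists_real_btwn.1 hk₂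
    refine hf₂ ?_
    filter_upwards [hA, hlimA.eventually (gt_mem_nhds (EReal.coe_lt_coe_iff.1 h1))] with t h3 h4
    exact not_lt.2 ((EReal.coe_le_coe_iff.2 (h3.trans h4.le)).trans h2.le)

theorem IsForwardSolution.reflect {a b : ℝ} {γ : ℝ → ℝ × ℝ}
    (hγ : IsForwardSolution (cdkField a b) γ) :
    IsForwardSolution (cdkField a b) fun t => (-(γ t).1, (γ t).2) := by
  intro t ht
  have h1 : HasDerivWithinAt (fun t => (γ t).1) (cdkField a b (γ t)).1 (Ici 0) t :=
    (ContinuousLinearMap.fst ℝ ℝ ℝ).hasFDerivAt.comp_hasDerivWithinAt t (hγ t ht)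
  have h2 : HasDerivWithinAt (fun t => (γ t).2) (cdkField a b (γ t)).2 (Ici 0) t :=
    (ContinuousLinearMap.snd ℝ ℝ ℝ).hasFDerivAt.comp_hasDerivWithinAt t (hγ t ht)
  refine (h1.fun_neg.prodMk h2).congr_deriv ?_
  ext <;> simp only [cdkField] <;> ring

/-- A trajectory that tends to `(0, 1)` does so along a tangent direction. -/
theorem exists_direction {a b : ℝ} (hb : 0 < b) {γ : ℝ → ℝ × ℝ}
    (hγ : IsForwardSolution (cdkField a b) γ) (hlim : Tendsto γ atTop (𝓝 (0, 1))) :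
    ∃ d : ℝ × ℝ, Tendsto (fun t => ‖γ t - (0, 1)‖⁻¹ • (γ t - (0, 1))) atTop (𝓝 d) := by
  have hγc : ContinuousOn γ (Ici 0) := fun t ht => (hγ t ht).continuousWithinAt
  obtain ⟨I, hI⟩ := exists_eq_mul_exp (y := fun t => (γ t).1)
    (q := fun t => radialRate a ((γ t).1 ^ 2) ((γ t).2 - 1))
    ((show Continuous fun z : ℝ × ℝ => radialRate a (z.1 ^ 2) (z.2 - 1) by
      fun_prop).comp_continuousOn hγc) (fun t ht => (hγ.coords ht).1)
  have hpos : ∀ δ : ℝ → ℝ × ℝ, IsForwardSolution (cdkField a b) δ → (∀ t, 0 ≤ t → 0 < (δ t).1) →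
      Tendsto δ atTop (𝓝 (0, 1)) →
      ∃ d : ℝ × ℝ, Tendsto (fun t => ‖δ t - (0, 1)‖⁻¹ • (δ t - (0, 1))) atTop (𝓝 d) := by
    intro δ hδ hδpos hδlim
    obtain ⟨c, hc⟩ := exists_slope_limit hb hδ hδpos ((continuous_fst.tendsto _).comp hδlim)
    obtain ⟨d, hd⟩ := exists_direction_of_slope
      ((eventually_ge_atTop 0).mono fun t ht => hδpos t ht) hc
    refine ⟨d, hd.congr fun t => ?_⟩
    rw [show δ t - (0, 1) = ((δ t).1, (δ t).2 - 1) by ext <;> simp]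
  -- The sign of `x` is preserved. Negative `x` reduces to positive `x` by reflection. On the axis
  -- the linear equation for `w` keeps the direction constant.
  rcases lt_trichotomy (γ 0).1 0 with h | h | h
  · obtain ⟨d, hd⟩ := hpos _ hγ.reflect
      (fun t ht => by
        have := mul_pos (neg_pos.2 h) (Real.exp_pos (I t))
        have h1 := hI t ht
        simp only at h1 ⊢
        linarith)
      (by
        have := ((continuous_fst.neg.prodMk continuous_snd).tendsto ((0, 1) : ℝ × ℝ)).comp hlim
        simpa using! this)
    refine ⟨(-d.1, d.2), (((continuous_fst.neg.prodMk continuous_snd).tendsto d).comp hd).congr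
      fun t => ?_⟩
    have hn : ‖((-(γ t).1, (γ t).2) : ℝ × ℝ) - (0, 1)‖ = ‖γ t - (0, 1)‖ := by
      simp [Prod.norm_def]
    simp only [Function.comp, hn]
    ext <;> simp
  · have hx : ∀ t, 0 ≤ t → (γ t).1 = 0 := fun t ht => by
      have := hI t ht
      simpa only [h, zero_mul] using this
    obtain ⟨J, hJ⟩ := exists_eq_mul_exp (y := fun t => (γ t).2 - 1)
      (q := fun t => -(b * (1 + ((γ t).2 - 1)) ^ 2))
      ((show Continuous fun z : ℝ × ℝ => -(b * (1 + (z.2 - 1)) ^ 2) by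
        fun_prop).comp_continuousOn hγc) (fun t ht => by
          refine (hγ.coords ht).2.congr_deriv ?_
          rw [hx t ht]
          simp only [heightRate]
          ring)
    refine ⟨‖γ 0 - (0, 1)‖⁻¹ • (γ 0 - (0, 1)), tendsto_const_nhds.congr' ?_⟩
    filter_upwards [eventually_ge_atTop 0] with t ht
    have e : γ t - (0, 1) = Real.exp (J t) • (γ 0 - (0, 1)) := by
      ext
      · simp [hx t ht, h]
      · have := hJ t ht
        simp [this, mul_comm]
    rw [e, norm_inv_smul_smul (Real.exp_pos _)]
  · refine hpos γ hγ (fun t ht => ?_) hlim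
    rw [hI t ht]
    exact mul_pos h (Real.exp_pos _)

theorem cdkField_node {a b : ℝ} (hb : 0 < b) (hab : 1 < a ∨ a = 1 ∧ 1 < b) :
    IsAttractingNode (cdkField a b) (0, 1) := by
  obtain ⟨κ, hκ, ρ, hρ, hρ1, hV⟩ := exists_lyapunov hb hab
  refine ⟨cdkField_stationary a b, fun N hN => ?_, {z | sqDist z ≤ ρ}, sqDist_le_mem_nhds hρ,
    fun q hq => exists_forwardSolution_of_lyapunov hκ hρ hρ1 hV hq, fun γ hγ h0 _ => ?_⟩
  · obtain ⟨ρ', hρ', -, hsub⟩ := exists_sqDist_le_subset hN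
    refine ⟨_, sqDist_le_mem_nhds (lt_min hρ hρ'), fun γ hγ h0 t ht => hsub _ ?_⟩
    exact (sqDist_le_of_lyapunov hκ (lt_min hρ hρ')
      (fun z hz => hV z (hz.trans (min_le_left _ _))) (c := id) (fun _ _ => rfl) hγ h0 t ht).trans
      (min_le_right _ _)
  · have hlim := tendsto_of_tendsto_sqDist (tendsto_sqDist_of_lyapunov hκ hρ hV hγ h0)
    exact ⟨hlim, exists_direction hb hγ hlim⟩

theorem lemma3p2 (a b : ℝ) (ha : 0 < a) (hb : 0 < b) :
    (a < 1 →
      IsSaddlePoint (cdkField a b) (0, 1) ∧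
      UnstableManifoldTangentTo (cdkField a b) (0, 1) (1, 0) ∧
      StableManifoldTangentTo (cdkField a b) (0, 1) (0, 1)) ∧
    (a = 1 → 1 < b → IsAttractingNode (cdkField a b) (0, 1)) ∧
    (a = 1 → b < 1 →
      IsSaddlePoint (cdkField a b) (0, 1) ∧
      UnstableManifoldTangentTo (cdkField a b) (0, 1) (1, 0) ∧
      StableManifoldTangentTo (cdkField a b) (0, 1) (0, 1)) ∧
    (1 < a → IsAttractingNode (cdkField a b) (0, 1)) :=
  ⟨fun h => cdkField_saddle ha hb (Or.inl h), fun h h' => cdkField_node hb (Or.inr ⟨h, h'⟩),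
    fun h h' => cdkField_saddle ha hb (Or.inr ⟨h, h'⟩), fun h => cdkField_node hb (Or.inl h)⟩
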